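/- An instance of GMEG-Set consists of a simple connected undirected graph $G=(V,E)$ with $n=|V|$ vertices, non-negative rational edge weights $w(e)$ (given in binary as fractions), binary vertex costs $c(v)\in\{0,1\}$, and a set $E'\subseteq E$. An edge $e$ is monitored by a pair of distinct vertices $x,y$ if $e$ lies on all shortest paths (with respect to $w$) between $x$ and $y$. A GMEG-set is a set $M\subseteq V$ such that every edge of $E'$ is monitored by a pair of distinct vertices of $M$; its cost is $c(M)=\sum_{v\in M}c(v)$. The problem MEG-Set is the special case $w\equiv 1$, $c\equiv 1$, $E'=E$, where the input is just $G$ and the solutions are called MEG-sets. (a) There is an algorithm, running in time polynomial in the bit length of the input, that for every instance of GMEG-Set admitting a GMEG-set outputs a GMEG-set $M$ such that, for every minimum-cost GMEG-set $M^*$, $$c(M)\le 2\,c(M^*)^2\ln n=\bigl(2\,c(M^*)\ln n\bigr)\,c(M^*)\qquad\text{and}\qquad c(M)\le\sqrt{2\,c(V)\ln n}\;c(M^*).$$ That is, the algorithm has approximation ratio at most $2c(M^*)\ln n$ and at most $\sqrt{2c(V)\ln n}$. (b) There are a polynomial-time algorithm and a constant $C$ such that for every simple connected graph $G$ with $n$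 vertices the algorithm outputs a MEG-set $M$ of $G$ with $|M|\le C\sqrt{n\ln n}\;|M^*|$ for every minimum-cardinality MEG-set $M^*$ of $G$. That is, MEG-Set has a polynomial-time $O(\sqrt{n\log n})$-approximation algorithm. Polynomial time is measured on a random access machine with logarithmic (bit) cost. -/

import Mathlib

/-! ### A random access machine with logarithmic cost

Programs act on finitely many arrays of natural numbers of unbounded size, with indirect addressing.
Every evaluation of a subexpression is charged the number of bits of its value, so that time bounds
polynomial in the bit length of the input agree with those of Turing machines. -/

namespace RAM

/-- A memory: `s a i` is the content of cell `i` of array `a`. -/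
abbrev Store : Type := ℕ → ℕ → ℕ

/-- Arithmetic expressions. `get a i` reads the cell of array `a` whose index is the value of `i`;
`sub` is truncated subtraction, `div` is integer division (with `x / 0 = 0`). -/
inductive Expr : Type
  | lit (k : ℕ)
  | get (a : ℕ) (i : Expr)
  | add (e f : Expr)
  | sub (e f : Expr)
  | mul (e f : Expr)
  | div (e f : Expr)

/-- The value of an expression. -/
def Expr.eval (s : Store) : Expr → ℕ
  | .lit k => k
  | .get a i => s a (i.eval s)
  | .add e f => e.eval s + f.eval s
  | .sub e f => e.eval s - f.eval s
  | .mul e f => e.eval s * f.eval s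
  | .div e f => e.eval s / f.eval s

/-- The cost of evaluating an expression: each node costs one plus the number of bits of its
value. -/
def Expr.cost (s : Store) : Expr → ℕ
  | .lit k => 1 + Nat.size k
  | .get a i => i.cost s + (1 + Nat.size (s a (i.eval s)))
  | .add e f => e.cost s + f.cost s + (1 + Nat.size (e.eval s + f.eval s))
  | .sub e f => e.cost s + f.cost s + (1 + Nat.size (e.eval s - f.eval s))
  | .mul e f => e.cost s + f.cost s + (1 + Nat.size (e.eval s * f.eval s))
  | .div e f => e.cost s + f.cost s + (1 + Nat.size (e.eval s / f.eval s))

/-- Programs. `put a i e` writes the value of `e` to cell `i` of array `a`; `cond e p q` executes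
`p` if `e` is nonzero and `q` otherwise; `loop e p` repeats `p` as long as `e` is nonzero. -/
inductive Prog : Type
  | skip
  | put (a : ℕ) (i e : Expr)
  | seq (p q : Prog)
  | cond (e : Expr) (p q : Prog)
  | loop (e : Expr) (p : Prog)

/-- The store after the assignment of `x` to cell `i` of array `a`. -/
def Store.write (s : Store) (a i x : ℕ) : Store :=
  Function.update s a (Function.update (s a) i x)

/-- `Runs p s t k`: started on the store `s`, the program `p` halts with the store `t` after time
exactly `k`. -/
inductive Runs : Prog → Store → Store → ℕ → Prop
  | skip (s : Store) : Runs .skip s s 1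
  | put (a : ℕ) (i e : Expr) (s : Store) :
      Runs (.put a i e) s (s.write a (i.eval s) (e.eval s)) (i.cost s + e.cost s + 1)
  | seq {p q : Prog} {s t u : Store} {k l : ℕ} (hp : Runs p s t k) (hq : Runs q t u l) :
      Runs (.seq p q) s u (k + l + 1)
  | cond_true {e : Expr} {p : Prog} (q : Prog) {s t : Store} {k : ℕ}
      (he : e.eval s ≠ 0) (hp : Runs p s t k) : Runs (.cond e p q) s t (e.cost s + k + 1)
  | cond_false {e : Expr} (p : Prog) {q : Prog} {s t : Store} {k : ℕ}
      (he : e.eval s = 0) (hq : Runs q s t k) : Runs (.cond e p q) s t (e.cost s + k + 1)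
  | loop_true {e : Expr} {p : Prog} {s t u : Store} {k l : ℕ} (he : e.eval s ≠ 0)
      (hp : Runs p s t k) (hl : Runs (.loop e p) t u l) :
      Runs (.loop e p) s u (e.cost s + k + l + 1)
  | loop_false {e : Expr} (p : Prog) {s : Store} (he : e.eval s = 0) :
      Runs (.loop e p) s s (e.cost s + 1)

/-- Execution is deterministic. -/
theorem Runs.unique {p : Prog} {s t t' : Store} {k k' : ℕ} (h : Runs p s t k)
    (h' : Runs p s t' k') : t = t' ∧ k = k' := by
  induction h generalizing t' k' with
  | skip s => cases h'; exact ⟨rfl, rfl⟩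
  | put a i e s => cases h'; exact ⟨rfl, rfl⟩
  | seq hp hq ihp ihq =>
    cases h' with
    | seq hp' hq' =>
      obtain ⟨rfl, rfl⟩ := ihp hp'
      obtain ⟨rfl, rfl⟩ := ihq hq'
      exact ⟨rfl, rfl⟩
  | cond_true q he hp ihp =>
    cases h' with
    | cond_true _ he' hp' =>
      obtain ⟨rfl, rfl⟩ := ihp hp'
      exact ⟨rfl, rfl⟩
    | cond_false _ he' hp' => exact absurd he' he
  | cond_false p he hq ihq =>
    cases h' with
    | cond_true _ he' hp' => exact absurd he he'
    | cond_false _ he' hp' =>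
      obtain ⟨rfl, rfl⟩ := ihq hp'
      exact ⟨rfl, rfl⟩
  | loop_true he hp hl ihp ihl =>
    cases h' with
    | loop_true he' hp' hl' =>
      obtain ⟨rfl, rfl⟩ := ihp hp'
      obtain ⟨rfl, rfl⟩ := ihl hl'
      exact ⟨rfl, rfl⟩
    | loop_false _ he' => exact absurd he' he
  | loop_false p he =>
    cases h' with
    | loop_true he' hp' hl' => exact absurd he he'
    | loop_false _ he' => exact ⟨rfl, rfl⟩

/-- The initial store for an input that consists of finitely many finite arrays: array `a` holds the
`a`-th list, and all other cells are `0`. -/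
def load (x : List (List ℕ)) : Store :=
  fun a i => (x.getD a []).getD i 0

/-- The length of such an input: the total number of bits of all its entries, plus one per entry. -/
def inputLength (x : List (List ℕ)) : ℕ :=
  (x.map fun l => (l.map fun m => Nat.size m + 1).sum).sum

/-- The list of the entries of an `n × n` matrix, row by row: the entry `(u, v)` has
index `u * n + v`. -/
def matrixList {n : ℕ} (f : Fin n → Fin n → ℕ) : List ℕ :=
  List.ofFn fun k : Fin (n * n) => f k.divNat k.modNat

/-- A set of vertices `0, …, n - 1` is output through its indicator in array `0`. -/
def outputSet (n : ℕ) (t : Store) : Finset (Fin n) :=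
  Finset.univ.filter fun v => t 0 v ≠ 0

/-- On input `x`, the program `P` halts within time `B` and outputs the vertex set `M`. -/
def OutputsWithin (P : Prog) (x : List (List ℕ)) (B : ℕ) {n : ℕ} (M : Finset (Fin n)) : Prop :=
  ∃ (t : Store) (k : ℕ), Runs P (load x) t k ∧ k ≤ B ∧ outputSet n t = M

end RAM

/-! ### Monitoring edge-geodetic sets -/

/-- The input of the problem MEG-Set: a connected graph on the vertices `0, …, n - 1`. -/
structure MEG where
  n : ℕ
  G : SimpleGraph (Fin n)
  connected : G.Connected

namespace MEG

/-- The edge `e` lies on all shortest paths between `x` and `y`. -/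
def Monitors (I : MEG) (x y : Fin I.n) (e : Sym2 (Fin I.n)) : Prop :=
  ∀ p : I.G.Walk x y, p.IsPath → p.length = I.G.dist x y → e ∈ p.edges

/-- `M` is a MEG-set. -/
def IsSolution (I : MEG) (M : Finset (Fin I.n)) : Prop :=
  ∀ e ∈ I.G.edgeSet, ∃ x ∈ M, ∃ y ∈ M, x ≠ y ∧ I.Monitors x y e

/-- `M` is a MEG-set of minimum cardinality. -/
def IsOptimal (I : MEG) (M : Finset (Fin I.n)) : Prop :=
  I.IsSolution M ∧ ∀ M' : Finset (Fin I.n), I.IsSolution M' → M.card ≤ M'.card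

open Classical in
/-- The encoding of the input: the number of vertices and the adjacency matrix. -/
noncomputable def input (I : MEG) : List (List ℕ) :=
  [[I.n], RAM.matrixList fun u v => if I.G.Adj u v then 1 else 0]

end MEG

/-- The input of the problem GMEG-Set: a connected graph on the vertices `0, …, n - 1` with
non-negative rational edge weights (values of `w` outside the edge set are irrelevant), binary
vertex costs, and a set of edges to be monitored. -/
structure GMEG where
  n : ℕ
  G : SimpleGraph (Fin n)
  connected : G.Connected
  w : Sym2 (Fin n) → ℚ≥0
  c : Fin n → ℕ
  binary : ∀ v, c v = 0 ∨ c v = 1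
  targets : Set (Sym2 (Fin n))
  targets_subset : targets ⊆ G.edgeSet

namespace GMEG

/-- The weight of a walk. -/
def weight (I : GMEG) {x y : Fin I.n} (p : I.G.Walk x y) : ℚ≥0 :=
  (p.edges.map I.w).sum

/-- `p` is a shortest path with respect to the edge weights. -/
def IsShortest (I : GMEG) {x y : Fin I.n} (p : I.G.Walk x y) : Prop :=
  p.IsPath ∧ ∀ q : I.G.Walk x y, q.IsPath → I.weight p ≤ I.weight q

/-- The edge `e` lies on all shortest paths between `x` and `y`. -/
def Monitors (I : GMEG) (x y : Fin I.n) (e : Sym2 (Fin I.n)) : Prop :=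
  ∀ p : I.G.Walk x y, I.IsShortest p → e ∈ p.edges

/-- `M` is a GMEG-set: each of the given edges is monitored by a pair of distinct vertices
of `M`. -/
def IsSolution (I : GMEG) (M : Finset (Fin I.n)) : Prop :=
  ∀ e ∈ I.targets, ∃ x ∈ M, ∃ y ∈ M, x ≠ y ∧ I.Monitors x y e

/-- The cost `c(M)` of a set of vertices. -/
def cost (I : GMEG) (M : Finset (Fin I.n)) : ℕ :=
  ∑ v ∈ M, I.c v

/-- `M` is a GMEG-set of minimum cost. -/
def IsOptimal (I : GMEG) (M : Finset (Fin I.n)) : Prop :=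
  I.IsSolution M ∧ ∀ M' : Finset (Fin I.n), I.IsSolution M' → I.cost M ≤ I.cost M'

open Classical in
/-- The encoding of the input: the number of vertices, the adjacency matrix, the numerators and the
denominators of the edge weights, the indicator matrix of the edges to be monitored, and the vertex
costs. -/
noncomputable def input (I : GMEG) : List (List ℕ) :=
  [[I.n],
    RAM.matrixList fun u v => if I.G.Adj u v then 1 else 0,
    RAM.matrixList fun u v => if I.G.Adj u v then (I.w s(u, v)).num else 0,
    RAM.matrixList fun u v => if I.G.Adj u v then (I.w s(u, v)).den else 0,
    RAM.matrixList fun u v => if s(u, v) ∈ I.targets then 1 else 0,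
    List.ofFn I.c]

end GMEG

/-! ### A bounded language of array programs, compiled to polynomial-time machine programs -/

namespace RAM

/-! Let `k = c(M*)`. Vertices of cost zero are taken for free. A greedy algorithm then repeatedly
adds a pair of vertices that maximizes the number of monitored targets. Each unmonitored target is
monitored by some pair of `M*`; after discarding free vertices, by one of the `P = k(k-1)/2` pairs
of vertices of cost one in `M*`. By averaging, the best pair settles at least a fraction `1/P` of
the remaining targets (`Greedy.step_of_two_le_cost`). At most `n²` ordered targets remain at the
start, so at most `1 + 2P ln n` steps occur, each of cost at most two, which gives `2k² ln n`
(`Greedy.cost_le`); `k ≤ 1` is treated apart. Multiplying this bound by `c(M) ≤ c(V)` and taking a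
square root gives the second bound. Part (b) is the case `c(V) = n`.

Whether a pair monitors an edge `e₀` is decided by distances alone. Make the weights integral,
double them, and add one to the weight of `e₀`. A path uses `e₀` at most once, so the new weight of
a path is twice the old one, plus one if it contains `e₀`. The order of unequal weights is kept and
ties are broken in favour of paths without `e₀`: the new distance is odd exactly if all shortest
paths contain `e₀` (`GMEG.odd_iff_monitors`). Bellman-Ford rounds compute these distances for every
choice of `e₀`.

For polynomial time on the bit-cost machine, the algorithm is written in a small language of
tabulations and bounded iterations. The danger is repeated squaring, so second factors of products
must be bounded independently of the changing arrays. Then each command lengthens values by an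
additive polynomial amount (`Cmd.bdd_exec`), which survives polynomially many repetitions, and
compilation preserves meaning at polynomial cost (`Cmd.runs`, `Cmd.exists_prog`). -/

/-- Binary operations of the array language. -/
inductive Op : Type
  | add | sub | mul | div | max | min

/-- The meaning of an operation. -/
def Op.apply : Op → ℕ → ℕ → ℕ
  | .add, a, b => a + b
  | .sub, a, b => a - b
  | .mul, a, b => a * b
  | .div, a, b => a / b
  | .max, a, b => a + (b - a)
  | .min, a, b => a - (a - b)

/-- The machine expression for an operation. -/
def Op.expr : Op → Expr → Expr → Expr
  | .add, e, f => .add e f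
  | .sub, e, f => .sub e f
  | .mul, e, f => .mul e f
  | .div, e, f => .div e f
  | .max, e, f => .add e (.sub f e)
  | .min, e, f => .sub e (.sub e f)

/-- Operations whose value never exceeds the first argument. -/
def Op.shrinks : Op → Bool
  | .sub => true
  | .div => true
  | .min => true
  | _ => false

/-- Iterated application of an operation. -/
def Op.fold (o : Op) (a : ℕ) (v : ℕ → ℕ) : ℕ → ℕ
  | 0 => a
  | i + 1 => o.apply (o.fold a v i) (v i)

/-- Terms: `var x` is the loop variable of level `x`; `fold o e f` accumulates with `o`, starting
with `e`, the values of `f` for all values below the loop bound of the next loop variable. -/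
inductive Term : Type
  | lit (k : ℕ)
  | var (x : ℕ)
  | get (a : ℕ) (i : Term)
  | bin (o : Op) (e f : Term)
  | fold (o : Op) (e f : Term)

/-- The value of a term with loop bound `n`, loop variables `ρ 0, …, ρ (l - 1)` and arrays `σ`. -/
def Term.eval (n : ℕ) (σ : Store) : Term → ℕ → (ℕ → ℕ) → ℕ
  | .lit k, _, _ => k
  | .var x, _, ρ => ρ x
  | .get a i, l, ρ => σ a (i.eval n σ l ρ)
  | .bin o e f, l, ρ => o.apply (e.eval n σ l ρ) (f.eval n σ l ρ)
  | .fold o e f, l, ρ =>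
    o.fold (e.eval n σ l ρ) (fun i => f.eval n σ (l + 1) (Function.update ρ l i)) n

/-- Arrays that programs never change. -/
def isInput (a : ℕ) : Bool := decide (1 ≤ a) && decide (a ≤ 6)

/-- Terms whose values are bounded independently of the contents of the changing arrays. -/
def Term.small : Term → Bool
  | .lit _ => true
  | .var _ => true
  | .get a _ => isInput a
  | .bin o e f => e.small && (f.small || o.shrinks)
  | .fold o e f => e.small && (f.small || o.shrinks)

/-- Whether `o` is multiplication. -/
def Op.isMul : Op → Bool
  | .mul => true
  | _ => false

/-- Well-formed terms: the two scratch arrays are not read, all variables are bound, and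
second factors are small. -/
def Term.WF : Term → ℕ → Bool
  | .lit _, _ => true
  | .var x, l => decide (x < l)
  | .get a i, l => decide (a ≠ 7) && decide (a ≠ 8) && i.WF l
  | .bin o e f, l => e.WF l && f.WF l && (!o.isMul || f.small)
  | .fold o e f, l => e.WF l && f.WF (l + 1) && (!o.isMul || f.small)

/-- Compilation of terms: the value is put into register `d`, loop variables are in array `7`. -/
def Term.comp : Term → ℕ → ℕ → Prog
  | .lit k, _, d => .put 8 (.lit d) (.lit k)
  | .var x, _, d => .put 8 (.lit d) (.get 7 (.lit x))
  | .get a i, l, d => .seq (i.comp l d) (.put 8 (.lit d) (.get a (.get 8 (.lit d))))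
  | .bin o e f, l, d => .seq (e.comp l d) (.seq (f.comp l (d + 1))
      (.put 8 (.lit d) (o.expr (.get 8 (.lit d)) (.get 8 (.lit (d + 1))))))
  | .fold o e f, l, d => .seq (e.comp l d) (.seq (.put 7 (.lit l) (.lit 0))
      (.loop (.sub (.get 6 (.lit 0)) (.get 7 (.lit l))) (.seq (f.comp (l + 1) (d + 1))
        (.seq (.put 8 (.lit d) (o.expr (.get 8 (.lit d)) (.get 8 (.lit (d + 1)))))
          (.put 7 (.lit l) (.add (.get 7 (.lit l)) (.lit 1)))))))

/-- Commands: `tab k a e` assigns the value of `e` at `m` to cell `m` of array `a`, for all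
`m < n ^ k` in increasing order; `iter k p` executes `p` for `n ^ k` times. -/
inductive Cmd : Type
  | tab (k a : ℕ) (e : Term)
  | seq (p q : Cmd)
  | iter (k : ℕ) (p : Cmd)

/-- The environment with a single loop variable. -/
def env1 (m : ℕ) : ℕ → ℕ := Function.update (fun _ => 0) 0 m

/-- The first `m` assignments of a tabulation. -/
def tabulate (n a : ℕ) (e : Term) (σ : Store) : ℕ → Store
  | 0 => σ
  | m + 1 => (tabulate n a e σ m).write a m (e.eval n (tabulate n a e σ m) 1 (env1 m))

/-- The meaning of commands. -/
def Cmd.exec (n : ℕ) : Cmd → Store → Store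
  | .tab k a e, σ => tabulate n a e σ (n ^ k)
  | .seq p q, σ => q.exec n (p.exec n σ)
  | .iter k p, σ => (p.exec n)^[n ^ k] σ

/-- The `k`-th power of the loop bound. -/
def boundPow : ℕ → Expr
  | 0 => .lit 1
  | k + 1 => .mul (boundPow k) (.get 6 (.lit 0))

/-- Compilation of commands, using the registers from `d` on. -/
def Cmd.comp : Cmd → ℕ → Prog
  | .tab k a e, d => .seq (.put 7 (.lit 0) (.lit 0))
      (.loop (.sub (boundPow k) (.get 7 (.lit 0))) (.seq (e.comp 1 d)
        (.seq (.put a (.get 7 (.lit 0)) (.get 8 (.lit d)))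
          (.put 7 (.lit 0) (.add (.get 7 (.lit 0)) (.lit 1))))))
  | .seq p q, d => .seq (p.comp d) (q.comp d)
  | .iter k p, d => .seq (.put 8 (.lit d) (.lit 0))
      (.loop (.sub (boundPow k) (.get 8 (.lit d))) (.seq (p.comp (d + 1))
        (.put 8 (.lit d) (.add (.get 8 (.lit d)) (.lit 1)))))

/-- Well-formed commands: inputs and scratch arrays are not written. -/
def Cmd.WF : Cmd → Bool
  | .tab _ a e => decide (a = 0 ∨ 8 < a) && e.WF 1
  | .seq p q => p.WF && q.WF
  | .iter _ p => p.WF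

/-! #### Sizes of values -/

/-- Inputs have at most `X` bits per cell, other arrays at most `B + X`. -/
def Bdd (X B : ℕ) (σ : Store) : Prop :=
  ∀ a i, Nat.size (σ a i) ≤ (bif isInput a then 0 else B) + X

theorem Nat_size_le_self (a : ℕ) : Nat.size a ≤ a := Nat.size_le.2 a.lt_two_pow_self

theorem Nat_size_add_le {a b A : ℕ} (ha : Nat.size a ≤ A) (hb : Nat.size b ≤ A) :
    Nat.size (a + b) ≤ A + 1 := by
  rw [Nat.size_le] at *
  rw [pow_succ]; omega

theorem Nat_size_mul_le {a b A C : ℕ} (ha : Nat.size a ≤ A) (hb : Nat.size b ≤ C) :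
    Nat.size (a * b) ≤ A + C := by
  rw [Nat.size_le] at *
  rw [pow_add]
  exact Nat.mul_lt_mul'' ha hb

theorem Op.apply_le_of_shrinks {o : Op} (h : o.shrinks = true) (a v : ℕ) : o.apply a v ≤ a := by
  cases o <;> simp_all [Op.shrinks, Op.apply, Nat.div_le_self]

/-- The common length bound `A` grows only additively: by a carry bit for sums (the maximum is
computed as a sum), by the length of the second factor for products. -/
theorem Op.size_apply_le (o : Op) {a v A C : ℕ} (ha : Nat.size a ≤ A) (hv : Nat.size v ≤ A)
    (hm : o.isMul = true → Nat.size v ≤ C) (hC : 1 ≤ C) : Nat.size (o.apply a v) ≤ A + C := by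
  cases o
  · exact (Nat_size_add_le ha hv).trans (by omega)
  · exact (Nat.size_le_size (Nat.sub_le _ _)).trans (by omega)
  · exact Nat_size_mul_le ha (hm rfl)
  · exact (Nat.size_le_size (Nat.div_le_self _ _)).trans (by omega)
  · refine (Nat_size_add_le ha ((Nat.size_le_size (Nat.sub_le _ _)).trans hv)).trans (by omega)
  · exact (Nat.size_le_size (Nat.sub_le _ _)).trans (by omega)

theorem Op.fold_le_of_shrinks {o : Op} (h : o.shrinks = true) (a : ℕ) (v : ℕ → ℕ) (n : ℕ) :
    o.fold a v n ≤ a := by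
  induction n with
  | zero => exact le_rfl
  | succ n ih => exact (o.apply_le_of_shrinks h _ _).trans ih

theorem Op.size_fold_le (o : Op) {a A C : ℕ} {v : ℕ → ℕ} {n : ℕ} (ha : Nat.size a ≤ A)
    (hv : ∀ i < n, Nat.size (v i) ≤ A) (hm : o.isMul = true → ∀ i < n, Nat.size (v i) ≤ C)
    (hC : 1 ≤ C) : Nat.size (o.fold a v n) ≤ A + n * C := by
  induction n with
  | zero => simpa [Op.fold] using ha
  | succ n ih =>
    have h1 := ih (fun i hi => hv i (by omega)) (fun h i hi => hm h i (by omega))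
    have h2 := hv n (by omega)
    have := o.size_apply_le (A := A + n * C) (C := C) h1 (by omega) (fun h => hm h n (by omega)) hC
    rw [Op.fold, Nat.succ_mul]; omega

theorem one_le_pow_of_two_le {X : ℕ} (hX : 2 ≤ X) (T : ℕ) : 1 ≤ X ^ T :=
  Nat.one_le_pow _ _ (by omega)

theorem le_pow_of_two_le {X : ℕ} (hX : 2 ≤ X) (c : ℕ) : c ≤ X ^ c :=
  c.lt_two_pow_self.le.trans (Nat.pow_le_pow_left hX c)

theorem pow_le_pow_of_two_le {X : ℕ} (hX : 2 ≤ X) {S T : ℕ} (h : S ≤ T) : X ^ S ≤ X ^ T :=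
  Nat.pow_le_pow_right (by omega) h

/-- Since `X ≥ 2`, constant factors can be moved into the exponent; all explicit constants in the
bounds below disappear in this way. -/
theorem mul_pow_le {X : ℕ} (hX : 2 ≤ X) (c T : ℕ) : c * X ^ T ≤ X ^ (c + T) := by
  rw [pow_add]; exact Nat.mul_le_mul_right _ (le_pow_of_two_le hX c)

/-- Two scales are kept apart: the part `b`, inherited from the changing arrays, must not be
multiplied, whence `b₂ = 0` for products; the part `X ^ T` may grow polynomially. A shrinking
operation never exceeds its starting value, so the contribution of `b₂` is then irrelevant. -/
theorem Op.size_eval_fold (o : Op) {a X b b₁ b₂ T₁ T₂ n : ℕ} {v : ℕ → ℕ} (hX : 2 ≤ X)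
    (hn : n ≤ X) (ha : Nat.size a ≤ b₁ + X ^ T₁) (hv : ∀ i < n, Nat.size (v i) ≤ b₂ + X ^ T₂)
    (hm : o.isMul = true → b₂ = 0) (h₁ : b₁ ≤ b) (h₂ : b₂ ≤ b ∨ o.shrinks = true) :
    Nat.size (o.fold a v n) ≤ b + X ^ (T₁ + T₂ + 4) := by
  have e1 : X ^ T₁ + X ^ T₂ + X * X ^ T₂ ≤ X ^ (T₁ + T₂ + 4) := by
    have p1 := pow_le_pow_of_two_le hX (show T₁ ≤ T₁ + T₂ + 1 by omega)
    have p2 := pow_le_pow_of_two_le hX (show T₂ ≤ T₁ + T₂ + 1 by omega)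
    have p3 := pow_le_pow_of_two_le hX (show T₂ + 1 ≤ T₁ + T₂ + 1 by omega)
    have p4 := mul_pow_le hX 3 (T₁ + T₂ + 1)
    rw [pow_succ] at p3
    rw [show T₁ + T₂ + 4 = 3 + (T₁ + T₂ + 1) by omega]
    rw [mul_comm] at p3
    omega
  have e2 : n * X ^ T₂ ≤ X * X ^ T₂ := Nat.mul_le_mul_right _ hn
  rcases h₂ with h₂ | h₂
  · have := o.size_fold_le (A := b + X ^ T₁ + X ^ T₂) (C := X ^ T₂) (v := v) (n := n)
      (ha.trans (by omega)) (fun i hi => (hv i hi).trans (by omega))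
      (fun h i hi => (hv i hi).trans (by rw [hm h]; omega)) (one_le_pow_of_two_le hX _)
    omega
  · exact (Nat.size_le_size (o.fold_le_of_shrinks h₂ a v n)).trans (by omega)

/-- The exponent is uniform in the data, and `B` enters with coefficient at most one. An assignment
therefore adds bits to the stored values instead of multiplying their length by a constant. -/
theorem Term.size_eval_le (e : Term) : ∀ l K, e.WF l = true → ∃ T, ∀ n X B σ ρ, 2 ≤ X → n ≤ X →
    Bdd X B σ → (∀ x < l, Nat.size (ρ x) ≤ X ^ K) →
    Nat.size (e.eval n σ l ρ) ≤ (bif e.small then 0 else B) + X ^ T := by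
  induction e with
  | lit k =>
    intro l K _
    refine ⟨k, fun n X B σ ρ hX hn hB hρ => ?_⟩
    have := Nat_size_le_self k
    have := le_pow_of_two_le hX k
    simp only [Term.eval]; omega
  | var x =>
    intro l K h
    refine ⟨K, fun n X B σ ρ hX hn hB hρ => ?_⟩
    have := hρ x (by simpa [Term.WF] using h)
    simp only [Term.eval]; omega
  | get a i ih =>
    intro l K h
    refine ⟨1, fun n X B σ ρ hX hn hB hρ => ?_⟩
    simpa [Term.eval, Term.small] using hB a _
  | bin o e f ihe ihf =>
    intro l K h
    simp only [Term.WF, Bool.and_eq_true, Bool.or_eq_true, Bool.not_eq_true'] at h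
    obtain ⟨⟨he, hf⟩, hm⟩ := h
    obtain ⟨T₁, h₁⟩ := ihe l K he
    obtain ⟨T₂, h₂⟩ := ihf l K hf
    refine ⟨T₁ + T₂ + 4, fun n X B σ ρ hX hn hB hρ => ?_⟩
    -- A binary operation is a fold of length one.
    have := o.size_eval_fold (n := 1) (v := fun _ => f.eval n σ l ρ)
      (b := bif (Term.bin o e f).small then 0 else B) hX (by omega)
      (h₁ n X B σ ρ hX hn hB hρ) (fun _ _ => h₂ n X B σ ρ hX hn hB hρ)
    refine this ?_ ?_ ?_
    · intro h; rw [h] at hm; simp_all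
    · simp only [Term.small]; cases e.small <;> simp
    · simp only [Term.small]; cases e.small <;> cases f.small <;> cases o.shrinks <;> simp
  | fold o e f ihe ihf =>
    intro l K h
    simp only [Term.WF, Bool.and_eq_true, Bool.or_eq_true, Bool.not_eq_true'] at h
    obtain ⟨⟨he, hf⟩, hm⟩ := h
    obtain ⟨T₁, h₁⟩ := ihe l K he
    obtain ⟨T₂, h₂⟩ := ihf (l + 1) (K + 1) hf
    refine ⟨T₁ + T₂ + 4, fun n X B σ ρ hX hn hB hρ => ?_⟩
    refine o.size_eval_fold hX hn (h₁ n X B σ ρ hX hn hB hρ)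
      (fun i hi => h₂ n X B σ _ hX hn hB fun x hx => ?_) ?_ ?_ ?_
    · by_cases hxl : x = l
      · subst hxl
        have := le_pow_of_two_le hX 1
        have h3 := pow_le_pow_of_two_le hX (show 1 ≤ K + 1 by omega)
        have := Nat_size_le_self i
        simp only [Function.update_self]
        rw [pow_one] at h3; omega
      · rw [Function.update_of_ne hxl]
        exact (hρ x (by omega)).trans (pow_le_pow_of_two_le hX (by omega))
    · intro h; rw [h] at hm; simp_all
    · simp only [Term.small]; cases e.small <;> simp
    · simp only [Term.small]; cases e.small <;> cases f.small <;> cases o.shrinks <;> simp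

/-! ### Growth of the store under commands -/

theorem Store.write_of_ne {s : Store} {a i x b : ℕ} (h : b ≠ a) : (s.write a i x) b = s b := by
  simp [Store.write, h]

theorem Store.write_self (s : Store) (a i x : ℕ) : (s.write a i x) a i = x := by
  simp [Store.write]

theorem Store.write_apply (s : Store) (a i x b j : ℕ) :
    (s.write a i x) b j = if b = a ∧ j = i then x else s b j := by
  by_cases h : b = a
  · subst h; by_cases h' : j = i <;> simp [Store.write, h']
  · simp [Store.write, h]

theorem tabulate_of_ne {n a : ℕ} {e : Term} {σ : Store} {b : ℕ} (h : b ≠ a) (m : ℕ) :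
    tabulate n a e σ m b = σ b := by
  induction m with
  | zero => rfl
  | succ m ih => rw [tabulate, Store.write_of_ne h, ih]

theorem Bdd.mono {X B C : ℕ} {σ : Store} (h : Bdd X B σ) (hBC : B ≤ C) : Bdd X C σ := by
  intro a i
  have := h a i
  cases hc : isInput a <;> simp only [hc, cond_true, cond_false] at this ⊢ <;> omega

theorem isInput_eq_false {a : ℕ} (h : a = 0 ∨ 8 < a) : isInput a = false := by
  simp [isInput]; omega

/-- Later entries may depend on earlier ones, because the tabulation works in place; hence the
growth is proportional to the number of assignments made. -/
theorem bdd_tabulate {e : Term} (h : e.WF 1 = true) (k : ℕ) : ∃ T, ∀ n X B σ a, 2 ≤ X → n ≤ X →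
    (a = 0 ∨ 8 < a) → Bdd X B σ → ∀ m ≤ n ^ k, Bdd X (B + m * X ^ T) (tabulate n a e σ m) := by
  obtain ⟨T, hT⟩ := e.size_eval_le 1 k h
  refine ⟨T, fun n X B σ a hX hn ha hB m hm => ?_⟩
  induction m with
  | zero => simpa [tabulate] using hB
  | succ m ih =>
    have ih := ih (by omega)
    have hm' : m ≤ X ^ k := (by omega : m ≤ n ^ k).trans (Nat.pow_le_pow_left hn k)
    have := hT n X _ _ (env1 m) hX hn ih (by
      intro x hx
      obtain rfl : x = 0 := by omega
      exact (Nat_size_le_self m).trans hm')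
    intro b j
    rw [tabulate, Store.write_apply, Nat.succ_mul]
    split_ifs with h1
    · rw [h1.1, isInput_eq_false ha]
      cases hc : e.small <;> simp only [hc, cond_true, cond_false] at this ⊢ <;> omega
    · have := ih b j
      cases hc : isInput b <;> simp only [hc, cond_true, cond_false] at this ⊢ <;> omega

theorem Cmd.bdd_iterate {p : Cmd} {T : ℕ} (hT : ∀ n X B σ, 2 ≤ X → n ≤ X → Bdd X B σ →
    Bdd X (B + X ^ T) (p.exec n σ)) {n X B : ℕ} {σ : Store} (hX : 2 ≤ X) (hn : n ≤ X)
    (hB : Bdd X B σ) (m : ℕ) : Bdd X (B + m * X ^ T) ((p.exec n)^[m] σ) := by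
  induction m with
  | zero => simpa using hB
  | succ m ih =>
    rw [Function.iterate_succ_apply']
    refine (hT n X _ _ hX hn ih).mono ?_
    rw [Nat.succ_mul]; omega

/-- Additive growth is closed under composition and under `n ^ k`-fold iteration, where the factor
`n ^ k ≤ X ^ k` is absorbed by the exponent. -/
theorem Cmd.bdd_exec (p : Cmd) (h : p.WF = true) : ∃ T, ∀ n X B σ, 2 ≤ X → n ≤ X → Bdd X B σ →
    Bdd X (B + X ^ T) (p.exec n σ) := by
  induction p with
  | tab k a e =>
    simp only [Cmd.WF, Bool.and_eq_true, decide_eq_true_eq] at h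
    obtain ⟨T, hT⟩ := bdd_tabulate h.2 k
    refine ⟨k + T, fun n X B σ hX hn hB => (hT n X B σ a hX hn h.1 hB _ le_rfl).mono ?_⟩
    rw [pow_add]
    have := Nat.mul_le_mul_right (X ^ T) (Nat.pow_le_pow_left hn k)
    omega
  | seq p q ihp ihq =>
    simp only [Cmd.WF, Bool.and_eq_true] at h
    obtain ⟨T₁, h₁⟩ := ihp h.1
    obtain ⟨T₂, h₂⟩ := ihq h.2
    refine ⟨2 + (T₁ + T₂), fun n X B σ hX hn hB =>
      (h₂ n X _ _ hX hn (h₁ n X B σ hX hn hB)).mono ?_⟩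
    have := mul_pow_le hX 2 (T₁ + T₂)
    have := pow_le_pow_of_two_le hX (show T₁ ≤ T₁ + T₂ by omega)
    have := pow_le_pow_of_two_le hX (show T₂ ≤ T₁ + T₂ by omega)
    omega
  | iter k p ih =>
    obtain ⟨T, hT⟩ := ih (by simpa [Cmd.WF] using h)
    refine ⟨k + T, fun n X B σ hX hn hB => ?_⟩
    refine (Cmd.bdd_iterate hT hX hn hB (n ^ k)).mono ?_
    rw [pow_add]
    have := Nat.mul_le_mul_right (X ^ T) (Nat.pow_le_pow_left hn k)
    omega

/-- The input arrays are never changed. -/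
theorem Cmd.exec_input (p : Cmd) (h : p.WF = true) (n : ℕ) (σ : Store) {a : ℕ} (h₁ : 1 ≤ a)
    (h₂ : a ≤ 8) : p.exec n σ a = σ a := by
  induction p generalizing σ with
  | tab k b e =>
    simp only [Cmd.WF, Bool.and_eq_true, decide_eq_true_eq] at h
    exact tabulate_of_ne (by omega) _
  | seq p q ihp ihq =>
    simp only [Cmd.WF, Bool.and_eq_true] at h
    rw [Cmd.exec, ihq h.2, ihp h.1]
  | iter k p ih =>
    have ih := ih (by simpa [Cmd.WF] using h)
    rw [Cmd.exec]
    generalize n ^ k = m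
    induction m with
    | zero => rfl
    | succ m ihm => rw [Function.iterate_succ_apply', ih, ihm]

/-! #### Running times -/

/-- The shape of all bounds on running times. -/
def bd (B X T : ℕ) : ℕ := (B + 1) * X ^ T

theorem bd_mono {B X S T : ℕ} (hX : 2 ≤ X) (h : S ≤ T) : bd B X S ≤ bd B X T :=
  Nat.mul_le_mul_left _ (pow_le_pow_of_two_le hX h)

theorem le_bd {B X c T : ℕ} (hX : 2 ≤ X) (h : c ≤ T) : c ≤ bd B X T := by
  have := (le_pow_of_two_le hX c).trans (pow_le_pow_of_two_le hX h)
  exact this.trans (Nat.le_mul_of_pos_left _ (by omega))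

theorem mul_bd_le {B X T : ℕ} (hX : 2 ≤ X) (c : ℕ) : c * bd B X T ≤ bd B X (c + T) := by
  rw [bd, mul_left_comm]
  exact Nat.mul_le_mul_left _ (mul_pow_le hX c T)

theorem pow_mul_bd (B X k T : ℕ) : X ^ k * bd B X T = bd B X (k + T) := by
  rw [bd, bd, pow_add]; ring

theorem le_bd_of_le_add {B X S T x : ℕ} (b : Bool) (hX : 2 ≤ X)
    (h : x ≤ (bif b then 0 else B) + X ^ S) (hST : S ≤ T) : x ≤ bd B X T := by
  have h1 : x ≤ B + X ^ S := by cases b <;> simp_all; omega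
  have h2 : B + X ^ S ≤ bd B X S := by
    have := one_le_pow_of_two_le hX S
    rw [bd]; nlinarith
  exact h1.trans (h2.trans (bd_mono hX hST))

theorem Op.eval_expr (o : Op) (s : Store) (e f : Expr) :
    (o.expr e f).eval s = o.apply (e.eval s) (f.eval s) := by
  cases o <;> rfl

theorem Op.cost_expr_le (o : Op) (s : Store) (e f : Expr) :
    (o.expr e f).cost s ≤ 2 * e.cost s + 2 * f.cost s + Nat.size (e.eval s) + Nat.size (f.eval s) +
      Nat.size (o.apply (e.eval s) (f.eval s)) + 2 := by
  have h1 := Nat.size_le_size (Nat.sub_le (e.eval s) (f.eval s))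
  have h2 := Nat.size_le_size (Nat.sub_le (f.eval s) (e.eval s))
  cases o <;> simp only [Op.expr, Expr.cost, Op.apply, Expr.eval] <;> omega

/-- A loop with an invariant. -/
theorem runs_loop {g : Expr} {p : Prog} {m C : ℕ} (Inv : ℕ → Store → Prop)
    (hbody : ∀ i < m, ∀ s, Inv i s → g.eval s ≠ 0 ∧ g.cost s ≤ C ∧
      ∃ t k, Runs p s t k ∧ Inv (i + 1) t ∧ k ≤ C)
    (hend : ∀ s, Inv m s → g.eval s = 0 ∧ g.cost s ≤ C) {s : Store} (hs : Inv 0 s) :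
    ∃ t k, Runs (.loop g p) s t k ∧ Inv m t ∧ k ≤ (m + 1) * (2 * C + 1) := by
  suffices H : ∀ j i, i + j = m → ∀ s, Inv i s →
      ∃ t k, Runs (.loop g p) s t k ∧ Inv m t ∧ k ≤ (j + 1) * (2 * C + 1) by
    exact H m 0 (by omega) s hs
  intro j
  induction j with
  | zero =>
    intro i hi s hs
    obtain rfl : i = m := by omega
    obtain ⟨h0, hc⟩ := hend s hs
    exact ⟨s, _, .loop_false p h0, hs, by omega⟩
  | succ j ih =>
    intro i hi s hs
    obtain ⟨h0, hc, t, k, hr, ht, hk⟩ := hbody i (by omega) s hs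
    obtain ⟨u, k', hr', hu, hk'⟩ := ih (i + 1) (by omega) t ht
    refine ⟨u, _, .loop_true h0 hr hr', hu, ?_⟩
    rw [Nat.succ_mul (j + 1)]; omega

/-- The machine memory `s` agrees with the store `σ` outside of the scratch arrays. -/
def Agree (σ s : Store) : Prop := ∀ a, a ≠ 7 → a ≠ 8 → s a = σ a

theorem Agree.write_scratch {σ s : Store} (h : Agree σ s) {a : ℕ} (ha : a = 7 ∨ a = 8)
    (i x : ℕ) : Agree σ (s.write a i x) := by
  intro b h7 h8
  rw [Store.write_of_ne (by omega), h b h7 h8]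

theorem Agree.write {σ s : Store} (h : Agree σ s) {a : ℕ} (i x : ℕ) :
    Agree (σ.write a i x) (s.write a i x) := by
  intro b h7 h8
  ext j
  rw [Store.write_apply, Store.write_apply, h b h7 h8]

/-- The induction rests on a scratch discipline: code compiled for level `l` and register `d` may
destroy only loop variables from `l` on and registers from `d` on. Operands already computed and the
counters of outer loops thus survive. -/
theorem Term.runs (e : Term) : ∀ l d K, e.WF l = true → ∃ T, ∀ n X B σ ρ s, 2 ≤ X → n ≤ X →
    Bdd X B σ → (∀ x < l, Nat.size (ρ x) ≤ X ^ K) → σ 6 0 = n → Agree σ s →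
    (∀ x < l, s 7 x = ρ x) → ∃ t k, Runs (e.comp l d) s t k ∧ Agree σ t ∧ (∀ x < l, t 7 x = ρ x) ∧
      (∀ r < d, t 8 r = s 8 r) ∧ t 8 d = e.eval n σ l ρ ∧ k ≤ bd B X T := by
  induction e with
  | lit c =>
    intro l d K h
    refine ⟨3 + d + c, fun n X B σ ρ s hX hn hB hρ hσ hs hv => ⟨_, _, .put _ _ _ _,
      hs.write_scratch (.inr rfl) _ _, fun x hx => ?_, fun r hr => ?_, ?_, ?_⟩⟩
    · rw [Store.write_of_ne (by omega), hv x hx]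
    · rw [Store.write_apply, if_neg (by simp only [Expr.eval]; omega)]
    · exact Store.write_self _ _ _ _
    · refine le_trans ?_ (le_bd hX le_rfl)
      have := Nat_size_le_self d
      have := Nat_size_le_self c
      simp only [Expr.cost]; omega
  | var y =>
    intro l d K h
    obtain ⟨S, hS⟩ := (Term.var y).size_eval_le l K h
    refine ⟨3 + (d + y + 4 + S), fun n X B σ ρ s hX hn hB hρ hσ hs hv => ⟨_, _, .put _ _ _ _,
      hs.write_scratch (.inr rfl) _ _, fun x hx => ?_, fun r hr => ?_, ?_, ?_⟩⟩
    · rw [Store.write_of_ne (by omega), hv x hx]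
    · rw [Store.write_apply, if_neg (by simp only [Expr.eval]; omega)]
    · have h : y < l := by simpa [Term.WF] using h
      simp only [Expr.eval, Term.eval]
      rw [Store.write_self, hv y h]
    · have h : y < l := by simpa [Term.WF] using h
      refine le_trans ?_ (mul_bd_le hX 3)
      have := Nat_size_le_self d
      have := Nat_size_le_self y
      have h1 := le_bd_of_le_add (T := d + y + 4 + S) _ hX (hS n X B σ ρ hX hn hB hρ) (by omega)
      have := le_bd (B := B) hX (show d + y + 4 ≤ d + y + 4 + S by omega)
      simp only [Term.eval] at h1
      simp only [Expr.cost, Expr.eval, hv y h]; omega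
  | get a i ih =>
    intro l d K h
    obtain ⟨S₀, hS₀⟩ := (Term.get a i).size_eval_le l K h
    simp only [Term.WF, Bool.and_eq_true, decide_eq_true_eq] at h
    obtain ⟨S₁, hS₁⟩ := i.size_eval_le l K h.2
    obtain ⟨T, hT⟩ := ih l d K h.2
    refine ⟨5 + (2 * d + 6 + S₀ + S₁ + T), fun n X B σ ρ s hX hn hB hρ hσ hs hv => ?_⟩
    obtain ⟨t, k, hr, ht, htv, htr, htd, hk⟩ := hT n X B σ ρ s hX hn hB hρ hσ hs hv
    refine ⟨_, _, .seq hr (.put _ _ _ _), ht.write_scratch (.inr rfl) _ _, fun x hx => ?_,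
      fun r hr => ?_, ?_, ?_⟩
    · rw [Store.write_of_ne (by omega), htv x hx]
    · rw [Store.write_apply, if_neg (by simp only [Expr.eval]; omega), htr r hr]
    · simp only [Expr.eval, Term.eval]
      rw [Store.write_self, htd, ht a h.1.1 h.1.2]
    · refine le_trans ?_ (mul_bd_le hX 5)
      have := Nat_size_le_self d
      have h0 := le_bd_of_le_add (T := 2 * d + 6 + S₀ + S₁ + T) _ hX
        (hS₀ n X B σ ρ hX hn hB hρ) (by omega)
      have h1 := le_bd_of_le_add (T := 2 * d + 6 + S₀ + S₁ + T) _ hX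
        (hS₁ n X B σ ρ hX hn hB hρ) (by omega)
      have := le_bd (B := B) hX (show 2 * d + 6 ≤ 2 * d + 6 + S₀ + S₁ + T by omega)
      have := bd_mono (B := B) hX (show T ≤ 2 * d + 6 + S₀ + S₁ + T by omega)
      simp only [Term.eval] at h0
      simp only [Expr.cost, Expr.eval, htd, ht a h.1.1 h.1.2]; omega
  | bin o e f ihe ihf =>
    intro l d K h
    obtain ⟨S₀, hS₀⟩ := (Term.bin o e f).size_eval_le l K h
    simp only [Term.WF, Bool.and_eq_true] at h
    obtain ⟨⟨he, hf⟩, -⟩ := h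
    obtain ⟨S₁, hS₁⟩ := e.size_eval_le l K he
    obtain ⟨S₂, hS₂⟩ := f.size_eval_le l K hf
    obtain ⟨T₁, hT₁⟩ := ihe l d K he
    obtain ⟨T₂, hT₂⟩ := ihf l (d + 1) K hf
    generalize hZ : 5 * d + 20 + S₀ + S₁ + S₂ + T₁ + T₂ = Z
    refine ⟨10 + Z, fun n X B σ ρ s hX hn hB hρ hσ hs hv => ?_⟩
    obtain ⟨t, k, hr, ht, htv, htr, htd, hk⟩ := hT₁ n X B σ ρ s hX hn hB hρ hσ hs hv
    obtain ⟨u, k', hr', hu, huv, hur, hud, hk'⟩ := hT₂ n X B σ ρ t hX hn hB hρ hσ ht htv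
    have hud' : u 8 d = e.eval n σ l ρ := by rw [hur d (by omega), htd]
    refine ⟨_, _, .seq hr (.seq hr' (.put _ _ _ _)), hu.write_scratch (.inr rfl) _ _,
      fun x hx => ?_, fun r hr => ?_, ?_, ?_⟩
    · rw [Store.write_of_ne (by omega), huv x hx]
    · rw [Store.write_apply, if_neg (by simp only [Expr.eval]; omega), hur r (by omega), htr r hr]
    · simp only [Op.eval_expr, Expr.eval, Term.eval]
      rw [Store.write_self, hud, hud']
    · refine le_trans ?_ (mul_bd_le hX 10)
      have := Nat_size_le_self d
      have := Nat_size_le_self (d + 1)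
      have h0 := le_bd_of_le_add (T := Z) _ hX (hS₀ n X B σ ρ hX hn hB hρ) (by omega)
      have h1 := le_bd_of_le_add (T := Z) _ hX (hS₁ n X B σ ρ hX hn hB hρ) (by omega)
      have h2 := le_bd_of_le_add (T := Z) _ hX (hS₂ n X B σ ρ hX hn hB hρ) (by omega)
      have := le_bd (B := B) hX (show 5 * d + 20 ≤ Z by omega)
      have := bd_mono (B := B) hX (show T₁ ≤ Z by omega)
      have := bd_mono (B := B) hX (show T₂ ≤ Z by omega)
      have hc := o.cost_expr_le u (.get 8 (.lit d)) (.get 8 (.lit (d + 1)))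
      simp only [Term.eval] at h0
      simp only [Expr.cost, Expr.eval, hud, hud'] at hc ⊢; omega
  | fold o e f ihe ihf =>
    intro l d K h
    simp only [Term.WF, Bool.and_eq_true, Bool.or_eq_true, Bool.not_eq_true'] at h
    obtain ⟨⟨he, hf⟩, hm⟩ := h
    obtain ⟨S₁, hS₁⟩ := e.size_eval_le l K he
    obtain ⟨S₂, hS₂⟩ := f.size_eval_le (l + 1) (K + 1) hf
    obtain ⟨T₁, hT₁⟩ := ihe l d K he
    obtain ⟨T₂, hT₂⟩ := ihf (l + 1) (d + 1) (K + 1) hf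
    generalize hZ : 5 * d + 5 * l + 40 + S₁ + S₂ + T₁ + T₂ = Z
    refine ⟨4 + (2 + (41 + Z)), fun n X B σ ρ s hX hn hB hρ hσ hs hv => ?_⟩
    obtain ⟨t, k, hr, ht, htv, htr, htd, hk⟩ := hT₁ n X B σ ρ s hX hn hB hρ hσ hs hv
    have hρ' : ∀ i < n, ∀ x < l + 1, Nat.size (Function.update ρ l i x) ≤ X ^ (K + 1) := by
      intro i hi x hx
      by_cases hxl : x = l
      · subst hxl
        have h3 := pow_le_pow_of_two_le hX (show 1 ≤ K + 1 by omega)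
        have := Nat_size_le_self i
        rw [Function.update_self]
        rw [pow_one] at h3; omega
      · rw [Function.update_of_ne hxl]
        exact (hρ x (by omega)).trans (pow_le_pow_of_two_le hX (by omega))
    set v := fun i => f.eval n σ (l + 1) (Function.update ρ l i) with hvdef
    have hsv : ∀ i < n, Nat.size (v i) ≤ (bif f.small then 0 else B) + X ^ S₂ := fun i hi =>
      hS₂ n X B σ _ hX hn hB (hρ' i hi)
    have hsf : ∀ i ≤ n, Nat.size (o.fold (e.eval n σ l ρ) v i) ≤ bd B X Z := by
      intro i hi
      refine le_bd_of_le_add (S := S₁ + S₂ + 4) false hX (o.size_eval_fold hX (hi.trans hn)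
        (hS₁ n X B σ ρ hX hn hB hρ) (fun j hj => hsv j (by omega)) ?_ ?_ (.inl ?_)) (by omega)
      · intro h; rw [h] at hm; simp_all
      · cases e.small <;> simp
      · cases f.small <;> simp
    have hvals : ∀ i < n, Nat.size (v i) ≤ bd B X Z := fun i hi =>
      le_bd_of_le_add _ hX (hsv i hi) (by omega)
    have hconst := le_bd (B := B) hX (show 5 * d + 5 * l + 40 ≤ Z by omega)
    have hXZ : X ≤ bd B X Z := by
      have := bd_mono (B := B) hX (show 1 ≤ Z by omega)
      refine le_trans ?_ this
      rw [bd, pow_one]; exact Nat.le_mul_of_pos_left _ (by omega)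
    have hsl := Nat_size_le_self l
    have hsd := Nat_size_le_self d
    have hsd1 := Nat_size_le_self (d + 1)
    have hguard : ∀ w i, Agree σ w → w 7 l = i →
        (Expr.sub (.get 6 (.lit 0)) (.get 7 (.lit l))).eval w = n - i ∧
        (Expr.sub (.get 6 (.lit 0)) (.get 7 (.lit l))).cost w ≤ 2 * n + l + i + 6 := by
      intro w i hw hi
      have h6 : w 6 0 = n := by rw [hw 6 (by omega) (by omega), hσ]
      have := Nat_size_le_self i
      have := Nat_size_le_self n
      have := Nat_size_le_self (n - i)
      simp only [Expr.eval, Expr.cost, h6, hi, true_and, Nat.size_zero]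
      omega
    obtain ⟨u, k', hr', hu, hk'⟩ := runs_loop
      (g := .sub (.get 6 (.lit 0)) (.get 7 (.lit l)))
      (p := .seq (f.comp (l + 1) (d + 1))
        (.seq (.put 8 (.lit d) (o.expr (.get 8 (.lit d)) (.get 8 (.lit (d + 1)))))
          (.put 7 (.lit l) (.add (.get 7 (.lit l)) (.lit 1))))) (m := n) (C := 20 * bd B X Z)
      (fun i w => Agree σ w ∧ (∀ x < l, w 7 x = ρ x) ∧ w 7 l = i ∧ (∀ r < d, w 8 r = s 8 r) ∧
        w 8 d = o.fold (e.eval n σ l ρ) v i)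
      (by
        rintro i hi w ⟨hw, hwv, hwl, hwr, hwd⟩
        obtain ⟨hg, hc⟩ := hguard w i hw hwl
        refine ⟨by omega, by omega, ?_⟩
        obtain ⟨u, j, hur, hu, huv, hurr, hud, hj⟩ := hT₂ n X B σ (Function.update ρ l i) w hX hn hB
          (hρ' i hi) hσ hw (by
            intro x hx
            by_cases hxl : x = l
            · subst hxl; rw [Function.update_self, hwl]
            · rw [Function.update_of_ne hxl]; exact hwv x (by omega))
        have hud' : u 8 d = o.fold (e.eval n σ l ρ) v i := by rw [hurr d (by omega), hwd]
        have hul : u 7 l = i := by rw [huv l (by omega), Function.update_self]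
        have hud'' : u 8 (d + 1) = v i := hud
        refine ⟨_, _, .seq hur (.seq (.put _ _ _ _) (.put _ _ _ _)),
          ⟨(hu.write_scratch (.inr rfl) _ _).write_scratch (.inl rfl) _ _, ?_, ?_, ?_, ?_⟩, ?_⟩
        · intro x hx
          rw [Store.write_apply, if_neg (by simp only [Expr.eval]; omega),
            Store.write_of_ne (by omega), huv x (by omega), Function.update_of_ne (by omega)]
        · simp only [Expr.eval]
          rw [Store.write_self, Store.write_of_ne (by omega), hul]
        · intro r hr
          rw [Store.write_of_ne (by omega), Store.write_apply,
            if_neg (by simp only [Expr.eval]; omega), hurr r (by omega), hwr r hr]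
        · rw [Store.write_of_ne (by omega)]
          simp only [Op.eval_expr, Expr.eval]
          rw [Store.write_self, hud', hud'', Op.fold]
        · have hc := o.cost_expr_le u (.get 8 (.lit d)) (.get 8 (.lit (d + 1)))
          have h0 := hsf i hi.le
          have h1 := hvals i hi
          have h2 := hsf (i + 1) hi
          rw [Op.fold] at h2
          have := bd_mono (B := B) hX (show T₂ ≤ Z by omega)
          have := Nat_size_le_self i
          have := Nat_size_le_self (i + 1)
          simp only [Expr.cost, Expr.eval, hud', hud'', Store.write_of_ne (show 7 ≠ 8 by omega),
            hul, Nat.size_one] at hc ⊢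
          omega)
      (by
        rintro w ⟨hw, hwv, hwl, hwr, hwd⟩
        obtain ⟨hg, hc⟩ := hguard w n hw hwl
        exact ⟨by omega, by omega⟩)
      (s := t.write 7 l 0)
      ⟨ht.write_scratch (.inl rfl) _ _, fun x hx => by
          rw [Store.write_apply, if_neg (by omega), htv x hx],
        Store.write_self _ _ _ _, fun r hr => by rw [Store.write_of_ne (by omega), htr r hr],
        by rw [Store.write_of_ne (by omega), htd]; rfl⟩
    refine ⟨u, _, .seq hr (.seq (.put _ _ _ _) hr'), hu.1, hu.2.1, hu.2.2.2.1, ?_, ?_⟩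
    · rw [hu.2.2.2.2]; rfl
    -- There are `n + 1 ≤ X ^ 2` evaluations of the guard. Guard and body each fit into the budget
    -- `20 * bd B X Z`, and twice this plus one is at most `41 * bd B X Z`.
    · have h1 : (n + 1) * (2 * (20 * bd B X Z) + 1) ≤ X ^ 2 * bd B X (41 + Z) := by
        refine Nat.mul_le_mul ?_ (le_trans ?_ (mul_bd_le hX 41))
        · nlinarith
        · omega
      rw [pow_mul_bd] at h1
      refine le_trans ?_ (mul_bd_le hX 4)
      have := bd_mono (B := B) hX (show T₁ ≤ 2 + (41 + Z) by omega)
      have := le_bd (B := B) hX (show 5 * d + 5 * l + 40 ≤ 2 + (41 + Z) by omega)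
      simp only [Expr.cost, Nat.size_zero]; omega

/-- The later part of a computation starts on a store whose bound has already grown by `X ^ S`; its
running time still has the same shape in terms of the original `B`. -/
theorem bd_add_pow_le {B X S T : ℕ} (hX : 2 ≤ X) : bd (B + X ^ S) X T ≤ bd B X (S + T + 1) := by
  have h1 := one_le_pow_of_two_le hX S
  have h2 : X ^ (S + T + 1) = X ^ S * X * X ^ T := by ring
  rw [bd, bd, h2, ← mul_assoc]
  refine Nat.mul_le_mul_right _ ?_
  have : X ^ S * 2 ≤ X ^ S * X := Nat.mul_le_mul_left _ hX
  nlinarith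

theorem boundPow_eval {n : ℕ} {s : Store} (h : s 6 0 = n) (k : ℕ) :
    (boundPow k).eval s = n ^ k := by
  induction k with
  | zero => rfl
  | succ k ih => simp only [boundPow, Expr.eval, ih, h, pow_succ]

theorem boundPow_cost (k : ℕ) : ∃ T, ∀ n X s, 2 ≤ X → n ≤ X → s 6 0 = n →
    (boundPow k).cost s ≤ X ^ T := by
  induction k with
  | zero =>
    refine ⟨2, fun n X s hX hn h => le_trans ?_ (le_pow_of_two_le hX 2)⟩
    simp [boundPow, Expr.cost]
  | succ k ih =>
    obtain ⟨T, hT⟩ := ih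
    refine ⟨5 + (T + k + 2), fun n X s hX hn h => le_trans ?_ (mul_pow_le hX 5 _)⟩
    have h1 := hT n X s hX hn h
    have h2 := pow_le_pow_of_two_le hX (show T ≤ T + k + 2 by omega)
    have h3 := pow_le_pow_of_two_le hX (show k + 1 ≤ T + k + 2 by omega)
    have h4 := pow_le_pow_of_two_le hX (show 1 ≤ T + k + 2 by omega)
    have h5 := Nat.pow_le_pow_left hn (k + 1)
    have h6 := Nat_size_le_self (n ^ (k + 1))
    have h7 := Nat_size_le_self n
    have h8 := pow_le_pow_of_two_le hX (show 2 ≤ T + k + 2 by omega)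
    have h9 : 2 * 2 ≤ X ^ 2 := by rw [sq]; exact Nat.mul_le_mul hX hX
    rw [pow_one] at h4
    simp only [boundPow, Expr.cost, Expr.eval, h, boundPow_eval h, ← pow_succ, Nat.size_zero]
    omega

theorem guard_cost {n X T k i a d : ℕ} {s : Store} (hn : n ≤ X) (h : s 6 0 = n)
    (hc : (boundPow k).cost s ≤ X ^ T) (hi : s a d = i) (hik : i ≤ n ^ k) :
    (Expr.sub (boundPow k) (.get a (.lit d))).eval s = n ^ k - i ∧
    (Expr.sub (boundPow k) (.get a (.lit d))).cost s ≤ X ^ T + 2 * X ^ k + d + 3 := by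
  have h1 := Nat.pow_le_pow_left hn k
  have := Nat_size_le_self i
  have := Nat_size_le_self d
  have := Nat_size_le_self (n ^ k - i)
  simp only [Expr.eval, Expr.cost, boundPow_eval h, hi, true_and]
  omega

theorem Cmd.runs (p : Cmd) (h : p.WF = true) : ∀ d, ∃ T, ∀ n X B σ s, 2 ≤ X → n ≤ X →
    Bdd X B σ → σ 6 0 = n → Agree σ s → ∃ t k, Runs (p.comp d) s t k ∧ Agree (p.exec n σ) t ∧
      (∀ r < d, t 8 r = s 8 r) ∧ k ≤ bd B X T := by
  induction p with
  | tab k a e =>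
    intro d
    simp only [Cmd.WF, Bool.and_eq_true, decide_eq_true_eq] at h
    obtain ⟨ha, he⟩ := h
    obtain ⟨S₁, hS₁⟩ := e.size_eval_le 1 k he
    obtain ⟨S₂, hS₂⟩ := bdd_tabulate he k
    obtain ⟨T₁, hT₁⟩ := e.runs 1 d k he
    obtain ⟨T₂, hT₂⟩ := boundPow_cost k
    generalize hZ : 5 * d + 20 + S₁ + S₂ + T₁ + T₂ + 2 * k = Z
    refine ⟨4 + (k + 1 + (41 + Z)), fun n X B σ s hX hn hB hσ hs => ?_⟩
    have hconst := le_bd (B := B) hX (show 5 * d + 20 ≤ Z by omega)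
    have hXk : X ^ k ≤ bd B X Z := (pow_le_pow_of_two_le hX (show k ≤ Z by omega)).trans
      (Nat.le_mul_of_pos_left _ (by omega))
    have hXT : X ^ T₂ ≤ bd B X Z := (pow_le_pow_of_two_le hX (show T₂ ≤ Z by omega)).trans
      (Nat.le_mul_of_pos_left _ (by omega))
    have hsd := Nat_size_le_self d
    have hnX := Nat.pow_le_pow_left hn k
    have h6 : ∀ m w, Agree (tabulate n a e σ m) w → w 6 0 = n := by
      intro m w hw
      rw [hw 6 (by omega) (by omega), tabulate_of_ne (by omega), hσ]
    have hbdd : ∀ m ≤ n ^ k, Bdd X (B + X ^ (k + S₂)) (tabulate n a e σ m) := by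
      intro m hm
      refine (hS₂ n X B σ a hX hn ha hB m hm).mono ?_
      rw [pow_add]
      have := Nat.mul_le_mul_right (X ^ S₂) (hm.trans hnX)
      omega
    have henv : ∀ m ≤ n ^ k, ∀ x < 1, Nat.size (env1 m x) ≤ X ^ k := by
      intro m hm x hx
      obtain rfl : x = 0 := by omega
      exact (Nat_size_le_self m).trans (hm.trans hnX)
    obtain ⟨u, k', hr', hu, hk'⟩ := runs_loop
      (g := .sub (boundPow k) (.get 7 (.lit 0)))
      (p := .seq (e.comp 1 d) (.seq (.put a (.get 7 (.lit 0)) (.get 8 (.lit d)))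
          (.put 7 (.lit 0) (.add (.get 7 (.lit 0)) (.lit 1))))) (m := n ^ k) (C := 20 * bd B X Z)
      (fun m w => Agree (tabulate n a e σ m) w ∧ w 7 0 = m ∧ (∀ r < d, w 8 r = s 8 r))
      (by
        rintro m hm w ⟨hw, hwl, hwr⟩
        have hw6 := h6 m w hw
        obtain ⟨hg, hc⟩ := guard_cost hn hw6 (hT₂ n X w hX hn hw6) hwl hm.le
        refine ⟨by omega, by omega, ?_⟩
        obtain ⟨u, j, hur, hu, huv, hurr, hud, hj⟩ := hT₁ n X _ _ (env1 m) w hX hn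
          (hbdd m hm.le) (henv m hm.le) (by rw [tabulate_of_ne (by omega), hσ]) hw (by
            intro x hx
            obtain rfl : x = 0 := by omega
            rw [hwl]; rfl)
        have hu0 : u 7 0 = m := huv 0 (by omega)
        refine ⟨_, _, .seq hur (.seq (.put _ _ _ _) (.put _ _ _ _)), ⟨?_, ?_, ?_⟩, ?_⟩
        · refine Agree.write_scratch ?_ (.inl rfl) _ _
          simp only [Expr.eval, hu0, hud]
          exact hu.write _ _
        · simp only [Expr.eval]
          rw [Store.write_self, Store.write_of_ne (by omega), hu0]
        · intro r hr
          rw [Store.write_of_ne (by omega), Store.write_of_ne (by omega), hurr r hr, hwr r hr]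
        · have h0 := le_bd_of_le_add (T := S₁) _ hX
            (hS₁ n X _ _ (env1 m) hX hn (hbdd m hm.le) (henv m hm.le)) le_rfl
          have h1 := h0.trans (bd_add_pow_le hX)
          have h2 := hj.trans (bd_add_pow_le hX)
          have := bd_mono (B := B) hX (show k + S₂ + S₁ + 1 ≤ Z by omega)
          have := bd_mono (B := B) hX (show k + S₂ + T₁ + 1 ≤ Z by omega)
          have := Nat_size_le_self m
          have := Nat_size_le_self (m + 1)
          simp only [Expr.cost, Expr.eval, hu0, hud, Store.write_of_ne (show 7 ≠ a by omega),
            Nat.size_zero, Nat.size_one]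
          omega)
      (by
        rintro w ⟨hw, hwl, hwr⟩
        have hw6 := h6 _ w hw
        obtain ⟨hg, hc⟩ := guard_cost hn hw6 (hT₂ n X w hX hn hw6) hwl le_rfl
        exact ⟨by omega, by omega⟩)
      (s := s.write 7 0 0)
      ⟨hs.write_scratch (.inl rfl) _ _, Store.write_self _ _ _ _,
        fun r hr => by rw [Store.write_of_ne (by omega)]⟩
    refine ⟨u, _, .seq (.put _ _ _ _) hr', hu.1, hu.2.2, ?_⟩
    have h1 : (n ^ k + 1) * (2 * (20 * bd B X Z) + 1) ≤ X ^ (k + 1) * bd B X (41 + Z) := by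
      refine Nat.mul_le_mul ?_ (le_trans ?_ (mul_bd_le hX 41))
      · have := one_le_pow_of_two_le hX k
        rw [pow_succ]; nlinarith
      · omega
    rw [pow_mul_bd] at h1
    refine le_trans ?_ (mul_bd_le hX 4)
    have := le_bd (B := B) hX (show 20 ≤ k + 1 + (41 + Z) by omega)
    simp only [Expr.cost, Nat.size_zero]; omega
  | seq p q ihp ihq =>
    intro d
    simp only [Cmd.WF, Bool.and_eq_true] at h
    obtain ⟨S, hS⟩ := p.bdd_exec h.1
    obtain ⟨T₁, hT₁⟩ := ihp h.1 d
    obtain ⟨T₂, hT₂⟩ := ihq h.2 d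
    refine ⟨3 + (T₁ + (S + T₂ + 1)), fun n X B σ s hX hn hB hσ hs => ?_⟩
    obtain ⟨t, k, hr, ht, htr, hk⟩ := hT₁ n X B σ s hX hn hB hσ hs
    obtain ⟨u, k', hr', hu, hur, hk'⟩ := hT₂ n X _ _ t hX hn (hS n X B σ hX hn hB)
      (by rw [p.exec_input h.1 n σ (by omega) (by omega), hσ]) ht
    refine ⟨u, _, .seq hr hr', hu, fun r hrd => by rw [hur r hrd, htr r hrd], ?_⟩
    refine le_trans ?_ (mul_bd_le hX 3)
    have := hk'.trans (bd_add_pow_le hX)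
    have := bd_mono (B := B) hX (show S + T₂ + 1 ≤ T₁ + (S + T₂ + 1) by omega)
    have := bd_mono (B := B) hX (show T₁ ≤ T₁ + (S + T₂ + 1) by omega)
    have := le_bd (B := B) hX (show 1 ≤ T₁ + (S + T₂ + 1) by omega)
    omega
  | iter k p ih =>
    intro d
    have hp : p.WF = true := by simpa [Cmd.WF] using h
    obtain ⟨S, hS⟩ := p.bdd_exec hp
    obtain ⟨T₁, hT₁⟩ := ih hp (d + 1)
    obtain ⟨T₂, hT₂⟩ := boundPow_cost k
    generalize hZ : 5 * d + 20 + S + T₁ + T₂ + 2 * k = Z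
    refine ⟨4 + (k + 1 + (41 + Z)), fun n X B σ s hX hn hB hσ hs => ?_⟩
    have hconst := le_bd (B := B) hX (show 5 * d + 20 ≤ Z by omega)
    have hXk : X ^ k ≤ bd B X Z := (pow_le_pow_of_two_le hX (show k ≤ Z by omega)).trans
      (Nat.le_mul_of_pos_left _ (by omega))
    have hXT : X ^ T₂ ≤ bd B X Z := (pow_le_pow_of_two_le hX (show T₂ ≤ Z by omega)).trans
      (Nat.le_mul_of_pos_left _ (by omega))
    have hsd := Nat_size_le_self d
    have hnX := Nat.pow_le_pow_left hn k
    have hs6 : ∀ m, ((p.exec n)^[m] σ) 6 = σ 6 := by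
      intro m
      induction m with
      | zero => rfl
      | succ m ihm =>
        rw [Function.iterate_succ_apply', p.exec_input hp n _ (by omega) (by omega), ihm]
    have h6 : ∀ m w, Agree ((p.exec n)^[m] σ) w → w 6 0 = n := by
      intro m w hw
      rw [hw 6 (by omega) (by omega), hs6, hσ]
    have hbdd : ∀ m ≤ n ^ k, Bdd X (B + X ^ (k + S)) ((p.exec n)^[m] σ) := by
      intro m hm
      refine (Cmd.bdd_iterate hS hX hn hB m).mono ?_
      rw [pow_add]
      have := Nat.mul_le_mul_right (X ^ S) (hm.trans hnX)
      omega
    obtain ⟨u, k', hr', hu, hk'⟩ := runs_loop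
      (g := .sub (boundPow k) (.get 8 (.lit d)))
      (p := .seq (p.comp (d + 1)) (.put 8 (.lit d) (.add (.get 8 (.lit d)) (.lit 1))))
      (m := n ^ k) (C := 20 * bd B X Z)
      (fun m w => Agree ((p.exec n)^[m] σ) w ∧ w 8 d = m ∧ (∀ r < d, w 8 r = s 8 r))
      (by
        rintro m hm w ⟨hw, hwl, hwr⟩
        have hw6 := h6 m w hw
        obtain ⟨hg, hc⟩ := guard_cost hn hw6 (hT₂ n X w hX hn hw6) hwl hm.le
        refine ⟨by omega, by omega, ?_⟩
        obtain ⟨u, j, hur, hu, hurr, hj⟩ := hT₁ n X _ _ w hX hn (hbdd m hm.le)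
          (by rw [hs6, hσ]) hw
        have hu0 : u 8 d = m := by rw [hurr d (by omega), hwl]
        refine ⟨_, _, .seq hur (.put _ _ _ _), ⟨?_, ?_, ?_⟩, ?_⟩
        · rw [Function.iterate_succ_apply']
          exact hu.write_scratch (.inr rfl) _ _
        · simp only [Expr.eval]
          rw [Store.write_self, hu0]
        · intro r hr
          rw [Store.write_apply, if_neg (by simp only [Expr.eval]; omega), hurr r (by omega),
            hwr r hr]
        · have h2 := hj.trans (bd_add_pow_le hX)
          have := bd_mono (B := B) hX (show k + S + T₁ + 1 ≤ Z by omega)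
          have := Nat_size_le_self m
          have := Nat_size_le_self (m + 1)
          simp only [Expr.cost, Expr.eval, hu0, Nat.size_one]
          omega)
      (by
        rintro w ⟨hw, hwl, hwr⟩
        have hw6 := h6 _ w hw
        obtain ⟨hg, hc⟩ := guard_cost hn hw6 (hT₂ n X w hX hn hw6) hwl le_rfl
        exact ⟨by omega, by omega⟩)
      (s := s.write 8 d 0)
      ⟨hs.write_scratch (.inr rfl) _ _, Store.write_self _ _ _ _,
        fun r hr => by rw [Store.write_apply, if_neg (by omega)]⟩
    refine ⟨u, _, .seq (.put _ _ _ _) hr', hu.1, hu.2.2, ?_⟩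
    have h1 : (n ^ k + 1) * (2 * (20 * bd B X Z) + 1) ≤ X ^ (k + 1) * bd B X (41 + Z) := by
      refine Nat.mul_le_mul ?_ (le_trans ?_ (mul_bd_le hX 41))
      · have := one_le_pow_of_two_le hX k
        rw [pow_succ]; nlinarith
      · omega
    rw [pow_mul_bd] at h1
    refine le_trans ?_ (mul_bd_le hX 4)
    have := le_bd (B := B) hX (show 5 * d + 20 ≤ k + 1 + (41 + Z) by omega)
    simp only [Expr.cost, Nat.size_zero]; omega

/-! ### Running time in terms of the bit length of the input -/

theorem sum_map_size_le {l : List ℕ} {m : ℕ} (h : m ∈ l) :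
    Nat.size m + 1 ≤ (l.map fun m => Nat.size m + 1).sum :=
  List.single_le_sum (fun _ _ => Nat.zero_le _) _ (List.mem_map_of_mem h)

theorem size_load_le (x : List (List ℕ)) (a i : ℕ) : Nat.size (load x a i) ≤ inputLength x := by
  by_cases ha : a < x.length
  · by_cases hi : i < x[a].length
    · have h1 : load x a i = x[a][i] := by simp [load, ha, hi]
      have h2 := sum_map_size_le (List.getElem_mem hi)
      have h3 : (x[a].map fun m => Nat.size m + 1).sum ≤ inputLength x :=
        List.single_le_sum (fun _ _ => Nat.zero_le _) _
          (List.mem_map.2 ⟨_, List.getElem_mem ha, rfl⟩)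
      rw [h1]; omega
    · have h1 : load x a i = 0 := by simp [load, ha, not_lt.1 hi]
      simp [h1]
  · have h1 : load x a i = 0 := by simp [load, not_lt.1 ha]
    simp [h1]

/-- Every well-formed command can be executed by a machine program in polynomial time. -/
theorem Cmd.exists_prog (p : Cmd) (h : p.WF = true) : ∃ (P : Prog) (T : Polynomial ℕ),
    ∀ (x : List (List ℕ)) (n : ℕ), load x 0 0 = n → n ≤ inputLength x →
      OutputsWithin P x (T.eval (inputLength x))
        (outputSet n (p.exec n ((load x).write 6 0 n))) := by
  obtain ⟨T, hT⟩ := p.runs h 0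
  -- The loop bound is saved in array `6`, since array `0` also receives the output. With `X` the
  -- input length plus two and `B = 0`, the time bound `bd` is just `X ^ T`; the linear term pays
  -- for the saving.
  refine ⟨.seq (.put 6 (.lit 0) (.get 0 (.lit 0))) (p.comp 0),
    (Polynomial.X + 2) ^ T + (Polynomial.X + 8), fun x n hx hn => ?_⟩
  obtain ⟨t, k, hr, ht, -, hk⟩ := hT n (inputLength x + 2) 0 ((load x).write 6 0 n)
    ((load x).write 6 0 n) (by omega) (by omega) (by
      intro a i
      rw [Store.write_apply]
      have h1 := size_load_le x a i
      have h2 := Nat_size_le_self n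
      split_ifs <;> omega) (Store.write_self _ _ _ _) (fun _ _ _ => rfl)
  have hput : Runs (.put 6 (.lit 0) (.get 0 (.lit 0))) (load x)
      ((load x).write 6 0 n) ((Expr.lit 0).cost (load x) +
        (Expr.get 0 (.lit 0)).cost (load x) + 1) := by
    rw [← hx]; exact .put _ _ _ _
  refine ⟨t, _, .seq hput hr, ?_, ?_⟩
  · have := Nat_size_le_self n
    simp only [Expr.cost, Expr.eval, hx, Nat.size_zero, Polynomial.eval_add, Polynomial.eval_pow,
      Polynomial.eval_X, Polynomial.eval_ofNat]
    rw [bd] at hk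
    omega
  · rw [outputSet, outputSet, ht 0 (by omega) (by omega)]

end RAM

/-! ### The greedy algorithm -/

namespace Greedy

variable {n : ℕ} {T : Finset (Fin n × Fin n)} {mon : Fin n × Fin n → Fin n → Fin n → Prop}

/-- `e` is monitored by a pair of elements of `S`. -/
def Covers (mon : Fin n × Fin n → Fin n → Fin n → Prop) (S : Finset (Fin n)) (e : Fin n × Fin n) :
    Prop := ∃ x ∈ S, ∃ y ∈ S, mon e x y

theorem Covers.mono {S S' : Finset (Fin n)} {e : Fin n × Fin n} (h : Covers mon S e)
    (hS : S ⊆ S') : Covers mon S' e := by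
  obtain ⟨x, hx, y, hy, h⟩ := h
  exact ⟨x, hS hx, y, hS hy, h⟩

open Classical in
/-- The covered targets. -/
noncomputable def cov (T : Finset (Fin n × Fin n)) (mon : Fin n × Fin n → Fin n → Fin n → Prop)
    (S : Finset (Fin n)) : Finset (Fin n × Fin n) := T.filter (Covers mon S)

theorem mem_cov {S : Finset (Fin n)} {e : Fin n × Fin n} :
    e ∈ cov T mon S ↔ e ∈ T ∧ Covers mon S e := by simp [cov]

theorem cov_mono {S S' : Finset (Fin n)} (h : S ⊆ S') : cov T mon S ⊆ cov T mon S' := by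
  intro e he
  rw [mem_cov] at *
  exact ⟨he.1, he.2.mono h⟩

theorem cov_subset (S : Finset (Fin n)) : cov T mon S ⊆ T := fun _ he => (mem_cov.1 he).1

/-- One step of the greedy algorithm: if some target is not covered, then a pair of vertices with
the largest number of covered targets is added. -/
def Step (T : Finset (Fin n × Fin n)) (mon : Fin n × Fin n → Fin n → Fin n → Prop)
    (M M' : Finset (Fin n)) : Prop :=
  ((∀ e ∈ T, Covers mon M e) ∧ M' = M) ∨ ((¬ ∀ e ∈ T, Covers mon M e) ∧
    ∃ p q, M' = M ∪ {p, q} ∧ ∀ p' q', (cov T mon (M ∪ {p', q'})).card ≤ (cov T mon M').card)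

theorem Step.subset {M M' : Finset (Fin n)} (h : Step T mon M M') : M ⊆ M' := by
  rcases h with ⟨-, rfl⟩ | ⟨-, p, q, rfl, -⟩
  · exact subset_rfl
  · exact Finset.subset_union_left

/-- The number of targets that are not covered. -/
noncomputable def rest (T : Finset (Fin n × Fin n))
    (mon : Fin n × Fin n → Fin n → Fin n → Prop) (S : Finset (Fin n)) : ℕ := (T \ cov T mon S).card

theorem rest_eq (S : Finset (Fin n)) : rest T mon S + (cov T mon S).card = T.card :=
  Finset.card_sdiff_add_card_eq_card (cov_subset S)

theorem rest_eq_zero {S : Finset (Fin n)} : rest T mon S = 0 ↔ ∀ e ∈ T, Covers mon S e := by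
  rw [rest, Finset.card_eq_zero, Finset.sdiff_eq_empty_iff_subset]
  exact ⟨fun h e he => (mem_cov.1 (h he)).2, fun h e he => mem_cov.2 ⟨he, h e he⟩⟩

/-! ### Progress of one greedy step, compared with a given solution -/

variable {c : Fin n → ℕ} {M M' Mstar : Finset (Fin n)}

theorem card_filter_eq_cost (hc : ∀ v, c v = 0 ∨ c v = 1) (M : Finset (Fin n)) :
    (M.filter fun v => c v = 1).card = ∑ v ∈ M, c v := by
  rw [Finset.card_filter]
  refine Finset.sum_congr rfl fun v _ => ?_
  rcases hc v with h | h <;> simp [h]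

theorem mem_union_pair (hc : ∀ v, c v = 0 ∨ c v = 1) (hZ : ∀ v, c v = 0 → v ∈ M)
    {x p q : Fin n} (h : c x = 1 → x = p ∨ x = q) : x ∈ M ∪ {p, q} := by
  rcases hc x with h0 | h1
  · exact Finset.mem_union_left _ (hZ x h0)
  · rcases h h1 with rfl | rfl <;> simp

/-- If the solution has at most one costly vertex `v`, then `M` contains all its other vertices. The
maximum also ranges over degenerate pairs such as `{v, v}`, so one step covers everything. -/
theorem step_of_cost_le_one (hc : ∀ v, c v = 0 ∨ c v = 1) (hZ : ∀ v, c v = 0 → v ∈ M)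
    (hM : ∀ e ∈ T, Covers mon Mstar e) (hk : ∑ v ∈ Mstar, c v ≤ 1) (h : Step T mon M M') :
    rest T mon M' = 0 := by
  rcases h with ⟨h, rfl⟩ | ⟨h, p, q, -, hmax⟩
  · exact rest_eq_zero.2 h
  · rw [← card_filter_eq_cost hc] at hk
    have hv : ∃ v, ∀ x ∈ Mstar, c x = 1 → x = v := by
      rcases (Mstar.filter fun v => c v = 1).eq_empty_or_nonempty with h0 | ⟨v, hv⟩
      · exact ⟨p, fun x hx h1 => absurd (Finset.mem_filter.2 ⟨hx, h1⟩) (by rw [h0]; simp)⟩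
      · exact ⟨v, fun x hx h1 => Finset.card_le_one.1 hk x (Finset.mem_filter.2 ⟨hx, h1⟩) v hv⟩
    obtain ⟨v, hv⟩ := hv
    have hall : rest T mon (M ∪ {v, v}) = 0 := rest_eq_zero.2 fun e he => by
      obtain ⟨x, hx, y, hy, hxy⟩ := hM e he
      exact ⟨x, mem_union_pair hc hZ fun h => .inl (hv x hx h), y,
        mem_union_pair hc hZ fun h => .inl (hv y hy h), hxy⟩
    have h1 := rest_eq (T := T) (mon := mon) (M ∪ {v, v})
    have h2 := rest_eq (T := T) (mon := mon) M'
    have := hmax v v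
    omega

/-- A free vertex of the monitoring pair places no demand on the pair to be added, so it can be
replaced by an arbitrary further element of `K`; this produces two distinct elements of `K` in all
cases. -/
theorem exists_pair {K : Finset (Fin n)} (hK : 2 ≤ K.card) (hc : ∀ v, c v = 0 ∨ c v = 1)
    {x y : Fin n} (hx : c x = 1 → x ∈ K) (hy : c y = 1 → y ∈ K) (hxy : x ≠ y) :
    ∃ p ∈ K, ∃ q ∈ K, p ≠ q ∧ (c x = 1 → x = p) ∧ (c y = 1 → y = q) := by
  have h2 : 1 < K.card := by omega
  rcases hc x with h0 | h1 <;> rcases hc y with h0' | h1'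
  · obtain ⟨p, hp, q, hq, hpq⟩ := Finset.one_lt_card.1 h2
    exact ⟨p, hp, q, hq, hpq, by omega, by omega⟩
  · obtain ⟨p, hp, hpq⟩ := Finset.exists_mem_ne h2 y
    exact ⟨p, hp, y, hy h1', hpq, by omega, fun _ => rfl⟩
  · obtain ⟨p, hp, hpq⟩ := Finset.exists_mem_ne h2 x
    exact ⟨x, hx h1, p, hp, hpq.symm, fun _ => rfl, by omega⟩
  · exact ⟨x, hx h1, y, hy h1', hxy, fun _ => rfl, fun _ => rfl⟩

theorem Step.card_cov_le (h : Step T mon M M') (p q : Fin n) :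
    (cov T mon (M ∪ {p, q})).card ≤ (cov T mon M').card := by
  rcases h with ⟨h, rfl⟩ | ⟨h, p, q, -, hmax⟩
  · have := rest_eq_zero.2 h
    have h2 := rest_eq (T := T) (mon := mon) M'
    have := Finset.card_le_card (cov_subset (T := T) (mon := mon) (M' ∪ {p, q}))
    omega
  · exact hmax _ _

/-- Double counting between uncovered targets and ordered pairs of distinct costly vertices of the
solution. Every target is covered by at least two such pairs, `(p, q)` and `(q, p)`, and no pair
covers more new targets than the greedy choice. -/
theorem step_of_two_le_cost (hmon : ∀ e x y, mon e x y → x ≠ y) (hc : ∀ v, c v = 0 ∨ c v = 1)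
    (hZ : ∀ v, c v = 0 → v ∈ M) (hM : ∀ e ∈ T, Covers mon Mstar e) {k : ℕ}
    (hk : ∑ v ∈ Mstar, c v = k) (hk2 : 2 ≤ k) (h : Step T mon M M') :
    rest T mon M * 2 ≤ (k * k - k) * (rest T mon M - rest T mon M') := by
  classical
  rw [← card_filter_eq_cost hc] at hk
  set K := Mstar.filter fun v => c v = 1 with hKdef
  have hmemK : ∀ x ∈ Mstar, c x = 1 → x ∈ K := fun x hx h1 => Finset.mem_filter.2 ⟨hx, h1⟩
  have hoff : K.offDiag.card = k * k - k := by rw [Finset.offDiag_card, hk]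
  rw [← hoff]
  refine Finset.card_mul_le_card_mul
    (fun (e : Fin n × Fin n) (pq : Fin n × Fin n) => Covers mon (M ∪ {pq.1, pq.2}) e) ?_ ?_
  · intro e he
    obtain ⟨x, hx, y, hy, hxy⟩ := hM e (Finset.mem_sdiff.1 he).1
    obtain ⟨p, hp, q, hq, hpq, hxp, hyq⟩ := exists_pair (K := K) (by omega) hc (hmemK x hx)
      (hmemK y hy) (hmon e x y hxy)
    have : ({(p, q), (q, p)} : Finset (Fin n × Fin n)).card = 2 := by
      rw [Finset.card_pair]; simp [hpq]
    rw [← this]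
    refine Finset.card_le_card fun z hz => ?_
    rw [Finset.mem_bipartiteAbove, Finset.mem_offDiag]
    have hcov : ∀ p' q', (p' = p ∧ q' = q) ∨ (p' = q ∧ q' = p) → Covers mon (M ∪ {p', q'}) e :=
      fun p' q' h' => ⟨x, mem_union_pair hc hZ fun h => by rw [hxp h]; tauto, y,
        mem_union_pair hc hZ fun h => by rw [hyq h]; tauto, hxy⟩
    rw [Finset.mem_insert, Finset.mem_singleton] at hz
    rcases hz with rfl | rfl
    · exact ⟨⟨hp, hq, hpq⟩, hcov _ _ (.inl ⟨rfl, rfl⟩)⟩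
    · exact ⟨⟨hq, hp, hpq.symm⟩, hcov _ _ (.inr ⟨rfl, rfl⟩)⟩
  · rintro ⟨p, q⟩ -
    have h1 := h.card_cov_le p q
    have h2 := rest_eq (T := T) (mon := mon) M
    have h3 := rest_eq (T := T) (mon := mon) M'
    have h4 : (cov T mon M).card + ((T \ cov T mon M).bipartiteBelow
        (fun (e : Fin n × Fin n) (pq : Fin n × Fin n) => Covers mon (M ∪ {pq.1, pq.2}) e)
        (p, q)).card ≤ (cov T mon (M ∪ {p, q})).card := by
      rw [← Finset.card_union_of_disjoint]
      · refine Finset.card_le_card (Finset.union_subset (cov_mono Finset.subset_union_left) ?_)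
        intro e he
        rw [Finset.mem_bipartiteBelow, Finset.mem_sdiff] at he
        exact mem_cov.2 ⟨he.1.1, he.2⟩
      · rw [Finset.disjoint_right]
        intro e he
        rw [Finset.mem_bipartiteBelow, Finset.mem_sdiff] at he
        exact he.1.2
    omega

theorem Step.cost_le (hc : ∀ v, c v = 0 ∨ c v = 1) (h : Step T mon M M') :
    ∑ v ∈ M', c v ≤ ∑ v ∈ M, c v + 2 := by
  have h1 : ∀ v, c v ≤ 1 := fun v => by rcases hc v with h | h <;> omega
  rcases h with ⟨-, rfl⟩ | ⟨-, p, q, rfl, -⟩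
  · omega
  · have h2 : ∑ v ∈ M ∪ {p, q}, c v ≤ ∑ v ∈ M, c v + ∑ v ∈ {p, q}, c v := by
      rw [← Finset.sum_union_inter]; omega
    have h3 : ∑ v ∈ ({p, q} : Finset (Fin n)), c v ≤ 2 := by
      refine (Finset.sum_le_card_nsmul _ _ 1 fun v _ => h1 v).trans ?_
      simpa using Finset.card_le_two
    omega

/-- The greedy algorithm covers all targets after at most `n ^ 2` steps; the cost is at most
quadratic in the optimal cost, up to a logarithmic factor. -/
theorem cost_le (hmon : ∀ e x y, mon e x y → x ≠ y) (hc : ∀ v, c v = 0 ∨ c v = 1)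
    (S : ℕ → Finset (Fin n)) (h0 : ∀ v, v ∈ S 0 ↔ c v = 0)
    (hS : ∀ i, Step T mon (S i) (S (i + 1))) (hM : ∀ e ∈ T, Covers mon Mstar e) :
    (∀ e ∈ T, Covers mon (S (n ^ 2)) e) ∧
      ((∑ v ∈ S (n ^ 2), c v : ℕ) : ℝ) ≤ 2 * ((∑ v ∈ Mstar, c v : ℕ) : ℝ) ^ 2 * Real.log n := by
  obtain ⟨k, hk⟩ : ∃ k, ∑ v ∈ Mstar, c v = k := ⟨_, rfl⟩
  have hZ : ∀ i v, c v = 0 → v ∈ S i := by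
    intro i v hv
    induction i with
    | zero => exact (h0 v).2 hv
    | succ i ih => exact (hS i).subset ih
  set r := fun i => rest T mon (S i) with hr
  have hone : k ≤ 1 → ∀ i, r (i + 1) = 0 := fun h i =>
    step_of_cost_le_one hc (hZ i) hM (by omega) (hS i)
  have htwo : 2 ≤ k → ∀ i, r i * 2 ≤ (k * k - k) * (r i - r (i + 1)) := fun h i =>
    step_of_two_le_cost hmon hc (hZ i) hM hk h (hS i)
  -- Without progress the truncated difference in `htwo` would vanish and force `r i = 0`. Strict
  -- decrease from at most `n ^ 2` ordered pairs shows that `n ^ 2` steps suffice.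
  have hdec : ∀ i, 0 < r i → r (i + 1) < r i := by
    intro i hi
    rcases Nat.lt_or_ge 1 k with h | h
    · have := htwo h i
      by_contra hcon
      rw [Nat.sub_eq_zero_of_le (show r i ≤ r (i + 1) by omega)] at this
      omega
    · rw [hone h i]; exact hi
  have hr0 : r 0 ≤ n ^ 2 := by
    have h1 := rest_eq (T := T) (mon := mon) (S 0)
    have h2 := Finset.card_le_univ T
    simp only [Fintype.card_prod, Fintype.card_fin] at h2
    simp only [hr, sq]; omega
  have hbound : ∀ i, r i ≤ r 0 - i := by
    intro i
    induction i with
    | zero => omega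
    | succ i ih =>
      rcases Nat.eq_zero_or_pos (r i) with h | h
      · have : r (i + 1) = 0 := by
          rcases hS i with ⟨-, h'⟩ | ⟨h', -⟩
          · simp only [hr, h']; exact h
          · exact absurd (rest_eq_zero.1 h) h'
        omega
      · have := hdec i h; omega
  have hex : ∃ m, r m = 0 := ⟨n ^ 2, by have := hbound (n ^ 2); omega⟩
  obtain ⟨m, hm, hmin⟩ : ∃ m, r m = 0 ∧ ∀ i < m, r i ≠ 0 := by
    classical
    exact ⟨Nat.find hex, Nat.find_spec hex, fun i hi => Nat.find_min hex hi⟩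
  have hmn : m ≤ n ^ 2 := by
    by_contra h
    exact hmin (n ^ 2) (by omega) (by have := hbound (n ^ 2); omega)
  have hconst : ∀ j, S (m + j) = S m := by
    intro j
    induction j with
    | zero => rfl
    | succ j ih =>
      rcases hS (m + j) with ⟨-, h'⟩ | ⟨h', -⟩
      · rw [← add_assoc, h', ih]
      · rw [ih] at h'; exact absurd (rest_eq_zero.1 hm) h'
  have hend : S (n ^ 2) = S m := by
    rw [← hconst (n ^ 2 - m)]; congr 1; omega
  rw [hend, hk]
  refine ⟨rest_eq_zero.1 hm, ?_⟩
  have hcost : ∀ i, ∑ v ∈ S i, c v ≤ 2 * i := by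
    intro i
    induction i with
    | zero => exact (Finset.sum_eq_zero fun v hv => (h0 v).1 hv).le
    | succ i ih => have := (hS i).cost_le hc; omega
  have hcm := hcost m
  rcases Nat.eq_zero_or_pos m with h | hmpos
  · have : ∑ v ∈ S m, c v = 0 := by omega
    rw [this]
    rw [Nat.cast_zero]
    exact mul_nonneg (by positivity) (Real.log_natCast_nonneg n)
  -- some target is not covered by the vertices of cost zero
  have hnot : ¬ ∀ e ∈ T, Covers mon (S 0) e := fun h => hmin 0 hmpos (rest_eq_zero.2 h)
  push Not at hnot
  obtain ⟨e, he, hnc⟩ := hnot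
  obtain ⟨x, hx, y, hy, hxy⟩ := hM e he
  have hne := hmon e x y hxy
  have hn2 : 2 ≤ n := by
    have := x.isLt; have := y.isLt
    have : x.val ≠ y.val := fun h => hne (Fin.ext h)
    omega
  have hk1 : 1 ≤ k := by
    by_contra hk0
    have hz : ∀ v ∈ Mstar, c v = 0 := fun v hv => by
      have := Finset.single_le_sum (f := c) (fun _ _ => Nat.zero_le _) hv
      omega
    exact hnc ⟨x, (h0 x).2 (hz x hx), y, (h0 y).2 (hz y hy), hxy⟩
  have hlog2 : (0.69 : ℝ) ≤ Real.log n := by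
    have h1 := Real.log_two_gt_d9
    have h2 : Real.log 2 ≤ Real.log n := Real.log_le_log (by norm_num) (by exact_mod_cast hn2)
    linarith
  rcases Nat.lt_or_ge 1 k with hk2 | hk1'
  · obtain ⟨j, rfl⟩ : ∃ j, m = j + 1 := ⟨m - 1, by omega⟩
    have hkk : (2 : ℝ) ≤ k := by exact_mod_cast hk2
    -- The number of unordered pairs of costly vertices; each step leaves at most the fraction `1 -
    -- 1 / P ≤ exp (-1 / P)` of the targets.
    set P : ℝ := ((k : ℝ) * k - k) / 2 with hP
    have hPpos : 0 < P := by rw [hP]; nlinarith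
    have hstep : ∀ i, (r (i + 1) : ℝ) ≤ r i * Real.exp (-(1 / P)) := by
      intro i
      have h1 := htwo hk2 i
      have h2 : r (i + 1) ≤ r i := by
        rcases Nat.eq_zero_or_pos (r i) with h | h
        · have : r (i + 1) = 0 := by
            rcases hS i with ⟨-, h'⟩ | ⟨h', -⟩
            · simp only [hr, h']; exact h
            · exact absurd (rest_eq_zero.1 h) h'
          omega
        · exact (hdec i h).le
      have h3 : (r i : ℝ) * 2 ≤ (k * k - k) * (r i - r (i + 1)) := by
        have h4 : k ≤ k * k := Nat.le_mul_self k
        have := (Nat.cast_le (α := ℝ)).2 h1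
        push_cast [Nat.cast_sub h2, Nat.cast_sub h4] at this
        exact this
      have h5 : (r i : ℝ) ≤ P * (r i - r (i + 1)) := by rw [hP]; linarith
      have h6 : (r (i + 1) : ℝ) ≤ r i * (1 - 1 / P) := by
        have : (r i : ℝ) / P ≤ r i - r (i + 1) := by
          rw [div_le_iff₀ hPpos]; linarith
        have h7 : (r i : ℝ) * (1 - 1 / P) = r i - r i / P := by ring
        linarith
      refine h6.trans (mul_le_mul_of_nonneg_left ?_ (Nat.cast_nonneg _))
      have := Real.add_one_le_exp (-(1 / P))
      linarith
    have hexp : ∀ i : ℕ, (r i : ℝ) ≤ (n : ℝ) ^ 2 * Real.exp (-(i / P)) := by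
      intro i
      induction i with
      | zero => simpa using (by exact_mod_cast hr0 : (r 0 : ℝ) ≤ (n : ℝ) ^ 2)
      | succ i ih =>
        refine (hstep i).trans ((mul_le_mul_of_nonneg_right ih (Real.exp_pos _).le).trans_eq ?_)
        rw [mul_assoc, ← Real.exp_add]
        push_cast
        congr 2
        ring
    -- By minimality of `m = j + 1`, a target is still uncovered after `j` steps. Taking logarithms
    -- in `1 ≤ n² exp (-j / P)` bounds `j`.
    have h1 : (1 : ℝ) ≤ r j := by
      have := hmin j (by omega)
      exact_mod_cast Nat.one_le_iff_ne_zero.2 this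
    have h2 := h1.trans (hexp j)
    have hnpos : (0 : ℝ) < n := by positivity
    have h3 := Real.log_le_log one_pos h2
    rw [Real.log_one, Real.log_mul (by positivity) (by positivity), Real.log_pow,
      Real.log_exp] at h3
    have h4 : (j : ℝ) / P ≤ 2 * Real.log n := by push_cast at h3; linarith
    rw [div_le_iff₀ hPpos] at h4
    have h5 : ((∑ v ∈ S (j + 1), c v : ℕ) : ℝ) ≤ 2 * (j + 1) := by exact_mod_cast hcm
    -- The cost is at most `2(j + 1) ≤ 2(k² - k) ln n + 2`. The final `2` is absorbed by `2k ln n`,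
    -- as `k ≥ 2` and `ln n ≥ 0.69`.
    have h6 : 2 * Real.log n * P = (k * k - k) * Real.log n := by rw [hP]; ring
    have h7 : 1 ≤ (k : ℝ) * Real.log n := by nlinarith
    nlinarith
  · have hm1 : m = 1 := by
      by_contra h
      exact hmin 1 (by omega) (hone hk1' 0)
    obtain rfl : k = 1 := by omega
    subst hm1
    -- One step costs at most `2`, which is below `2 ln n` only for `n ≥ 3`. For `n = 2` the
    -- solution must be the whole vertex set, so no set costs more than `1 < 2 ln 2`.
    rcases hn2.eq_or_lt with h2 | h3
    · have hcard : Mstar = Finset.univ := by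
        refine Finset.eq_univ_of_card _ (le_antisymm (Finset.card_le_univ _) ?_)
        have := Finset.one_lt_card.2 ⟨x, hx, y, hy, hne⟩
        rw [Fintype.card_fin]; omega
      have h4 : ∑ v ∈ S 1, c v ≤ 1 := by
        rw [← hk, hcard]
        exact Finset.sum_le_sum_of_subset (Finset.subset_univ _)
      have : ((∑ v ∈ S 1, c v : ℕ) : ℝ) ≤ 1 := by exact_mod_cast h4
      push_cast
      push_cast at this
      linarith
    · have h4 : (1 : ℝ) ≤ Real.log n := by
        rw [Real.le_log_iff_exp_le (by positivity)]
        have h5 := Real.exp_one_lt_d9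
        have h6 : (3 : ℝ) ≤ n := by exact_mod_cast h3
        linarith
      have : ((∑ v ∈ S 1, c v : ℕ) : ℝ) ≤ 2 := by exact_mod_cast hcm
      push_cast
      push_cast at this
      linarith

end Greedy

/-! ### Shortest paths with perturbed weights -/

namespace GMEG

variable {I : GMEG} {ω : Sym2 (Fin I.n) → ℕ} {e₀ : Sym2 (Fin I.n)} {inf k : ℕ}
  {D D' W : Fin I.n → Fin I.n → ℕ}

open Classical in
/-- The weight of an edge is doubled, and the weight of `e₀` is increased by one. -/
noncomputable def perturbed (ω : Sym2 (Fin I.n) → ℕ) (e₀ e : Sym2 (Fin I.n)) : ℕ :=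
  2 * ω e + if e = e₀ then 1 else 0

/-- The weight of a walk after the perturbation. -/
noncomputable def perturbedWeight (ω : Sym2 (Fin I.n) → ℕ) (e₀ : Sym2 (Fin I.n)) {x y : Fin I.n}
    (p : I.G.Walk x y) : ℕ :=
  (p.edges.map (perturbed ω e₀)).sum

/-- The state after `k` rounds: entries are at most the weights of the walks with up to `k` edges,
and entries below `inf` are weights of walks. -/
def IsRound (ω : Sym2 (Fin I.n) → ℕ) (e₀ : Sym2 (Fin I.n)) (inf k : ℕ)
    (D : Fin I.n → Fin I.n → ℕ) : Prop :=
  (∀ x y (p : I.G.Walk x y), p.length ≤ k → D x y ≤ perturbedWeight ω e₀ p) ∧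
    ∀ x y, inf ≤ D x y ∨ ∃ p : I.G.Walk x y, D x y = perturbedWeight ω e₀ p

theorem isRound_zero (h : ∀ x, D x x = 0) (h' : ∀ x y, x ≠ y → inf ≤ D x y) :
    IsRound ω e₀ inf 0 D := by
  refine ⟨fun x y p hp => ?_, fun x y => ?_⟩
  · obtain rfl := p.eq_of_length_eq_zero (by omega)
    rw [h]; exact Nat.zero_le _
  · by_cases hxy : x = y
    · subst hxy
      exact .inr ⟨.nil, by rw [h]; rfl⟩
    · exact .inl (h' x y hxy)

/-- Walks are split at their first edge. A sum that involves a non-edge or an entry at least `inf`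
is again at least `inf`, so a finite number can play the role of infinity. -/
theorem IsRound.succ (hD : IsRound ω e₀ inf k D)
    (hW : ∀ x z, I.G.Adj x z → W x z = perturbed ω e₀ s(x, z))
    (hW' : ∀ x z, ¬ I.G.Adj x z → inf ≤ W x z) (h₁ : ∀ x y, D' x y ≤ D x y)
    (h₂ : ∀ x y z, D' x y ≤ D z y + W x z)
    (h₃ : ∀ x y, D' x y = D x y ∨ ∃ z, D' x y = D z y + W x z) :
    IsRound ω e₀ inf (k + 1) D' := by
  refine ⟨fun x y p hp => ?_, fun x y => ?_⟩
  · cases p with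
    | nil => exact (h₁ x x).trans (hD.1 x x .nil (by simp))
    | @cons _ z _ hadj q =>
      rw [SimpleGraph.Walk.length_cons] at hp
      have h4 := h₂ x y z
      have h5 := hD.1 z y q (by omega)
      rw [hW x z hadj] at h4
      simp only [perturbedWeight, SimpleGraph.Walk.edges_cons, List.map_cons, List.sum_cons] at *
      omega
  · rcases h₃ x y with h | ⟨z, h⟩
    · rw [h]; exact hD.2 x y
    · rw [h]
      by_cases hadj : I.G.Adj x z
      · rcases hD.2 z y with h4 | ⟨q, hq⟩
        · exact .inl (by omega)
        · refine .inr ⟨.cons hadj q, ?_⟩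
          rw [hq, hW x z hadj]
          simp only [perturbedWeight, SimpleGraph.Walk.edges_cons, List.map_cons, List.sum_cons]
          omega
      · exact .inl ((hW' x z hadj).trans (by omega))

/-- A path has at most `n - 1` edges, each of perturbed weight at most `S + 1`; this justifies `(S +
1) * n` as infinity. -/
theorem perturbedWeight_lt {S : ℕ} (hS : ∀ e ∈ I.G.edgeSet, 2 * ω e ≤ S) {x y : Fin I.n}
    {p : I.G.Walk x y} (hp : p.IsPath) : perturbedWeight ω e₀ p < (S + 1) * I.n := by
  have h1 : ∀ a ∈ p.edges.map (perturbed ω e₀), a ≤ S + 1 := by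
    intro a ha
    obtain ⟨e, he, rfl⟩ := List.mem_map.1 ha
    have := hS e (p.edges_subset_edgeSet he)
    rw [perturbed]; split_ifs <;> omega
  have h2 := List.sum_le_card_nsmul _ _ h1
  have h3 := hp.length_lt
  rw [List.length_map, SimpleGraph.Walk.length_edges, smul_eq_mul] at h2
  rw [Fintype.card_fin] at h3
  rw [perturbedWeight, mul_comm]
  exact h2.trans_lt (Nat.mul_lt_mul_of_pos_right h3 (Nat.succ_pos _))

/-- The edges of the bypass are distinct and occur in the walk, so they form a sub-multiset of its
edges, and weights are natural numbers. -/
theorem perturbedWeight_bypass_le {x y : Fin I.n} (p : I.G.Walk x y) :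
    perturbedWeight ω e₀ p.bypass ≤ perturbedWeight ω e₀ p := by
  classical
  have h1 : p.bypass.edges.Subperm p.edges :=
    List.subperm_of_subset p.bypass_isPath.isTrail.edges_nodup p.edges_bypass_subset_edges
  obtain ⟨l, hl, hsub⟩ := h1
  rw [perturbedWeight, perturbedWeight, ← (hl.map _).sum_eq]
  exact (hsub.map _).sum_le_sum (fun _ _ => Nat.zero_le _)

theorem perturbedWeight_of_isPath {x y : Fin I.n} {p : I.G.Walk x y} (hp : p.IsPath)
    [Decidable (e₀ ∈ p.edges)] :
    perturbedWeight ω e₀ p = 2 * (p.edges.map ω).sum + if e₀ ∈ p.edges then 1 else 0 := by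
  classical
  have h1 : ∀ l : List (Sym2 (Fin I.n)), l.Nodup → (l.map (perturbed ω e₀)).sum =
      2 * (l.map ω).sum + if e₀ ∈ l then 1 else 0 := by
    intro l hl
    induction l with
    | nil => simp
    | cons a l ih =>
      rw [List.nodup_cons] at hl
      rw [List.map_cons, List.sum_cons, ih hl.2, List.map_cons, List.sum_cons, perturbed]
      by_cases h : a = e₀
      · subst h
        simp only [hl.1, if_true, if_false, List.mem_cons_self]; omega
      · have h' : e₀ ≠ a := fun h' => h h'.symm
        simp only [h, if_false, List.mem_cons, h', false_or]; omega
  rw [perturbedWeight, h1 _ hp.isTrail.edges_nodup]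
  congr

/-- After `n` rounds the entry is the least perturbed weight of a path. Its parity tells whether the
minimizing path `p` contains `e₀`, and `p` avoids `e₀` as soon as some shortest path does. -/
theorem odd_iff_monitors {Δ : ℕ} (hΔ : 0 < Δ) (hω : ∀ e ∈ I.G.edgeSet, (ω e : ℚ≥0) = Δ * I.w e)
    {S : ℕ} (hS : ∀ e ∈ I.G.edgeSet, 2 * ω e ≤ S)
    (hD : IsRound ω e₀ ((S + 1) * I.n) I.n D) (x y : Fin I.n) :
    D x y % 2 = 1 ↔ I.Monitors x y e₀ := by
  classical
  have hle : ∀ q : I.G.Walk x y, q.IsPath → D x y ≤ perturbedWeight ω e₀ q := fun q hq =>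
    hD.1 x y q (by have := hq.length_lt; rw [Fintype.card_fin] at this; omega)
  have hwt : ∀ q : I.G.Walk x y, ((q.edges.map ω).sum : ℚ≥0) = Δ * I.weight q := by
    intro q
    have : ∀ l : List (Sym2 (Fin I.n)), (∀ e ∈ l, e ∈ I.G.edgeSet) →
        ((l.map ω).sum : ℚ≥0) = Δ * (l.map I.w).sum := by
      intro l hl
      induction l with
      | nil => simp
      | cons a l ih =>
        simp only [List.map_cons, List.sum_cons, Nat.cast_add, mul_add]
        rw [hω a (hl a List.mem_cons_self), ih fun e he => hl e (List.mem_cons_of_mem _ he)]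
    exact this _ fun e he => q.edges_subset_edgeSet he
  have hcmp : ∀ q q' : I.G.Walk x y, I.weight q ≤ I.weight q' ↔
      (q.edges.map ω).sum ≤ (q'.edges.map ω).sum := by
    intro q q'
    rw [← Nat.cast_le (α := ℚ≥0), hwt, hwt, mul_le_mul_iff_right₀ (by exact_mod_cast hΔ)]
  -- Connectedness puts the entry below the bound for infinity, so it is the weight of a walk;
  -- shortcutting this walk cannot beat the entry, hence keeps the weight.
  obtain ⟨p, hp, hDp⟩ : ∃ p : I.G.Walk x y, p.IsPath ∧ D x y = perturbedWeight ω e₀ p := by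
    obtain ⟨q⟩ := I.connected.preconnected x y
    have h1 := (hle q.bypass q.bypass_isPath).trans_lt (perturbedWeight_lt hS q.bypass_isPath)
    obtain ⟨p, hp⟩ := (hD.2 x y).resolve_left (by omega)
    refine ⟨p.bypass, p.bypass_isPath, le_antisymm (hle _ p.bypass_isPath) ?_⟩
    rw [hp]; exact perturbedWeight_bypass_le p
  rw [perturbedWeight_of_isPath hp] at hDp
  constructor
  · intro hodd q hq
    have h2 := hle q hq.1
    have h3 := (hcmp q p).1 (hq.2 p hp)
    rw [perturbedWeight_of_isPath hq.1] at h2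
    -- A shortest path `q` without `e₀` would have perturbed weight at most `2 ω(p)`, less than the
    -- odd entry `2 ω(p) + 1`.
    by_contra hcon
    rw [if_neg hcon] at h2
    split_ifs at hDp <;> omega
  · intro hmon
    -- The path `p` is shortest for the original weights: `2 ω(p) ≤ D x y ≤ 2 ω(q) + 1` implies
    -- `ω(p) ≤ ω(q)`.
    have : e₀ ∈ p.edges := hmon p ⟨hp, fun q hq => (hcmp p q).2 (by
      have h2 := hle q hq
      rw [perturbedWeight_of_isPath hq] at h2
      by_cases h5 : e₀ ∈ q.edges
      · rw [if_pos h5] at h2; omega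
      · rw [if_neg h5] at h2; omega)⟩
    rw [hDp, if_pos this]; omega

/-- A vertex does not monitor edges together with itself. -/
theorem Monitors.ne {e : Sym2 (Fin I.n)} {x y : Fin I.n} (h : I.Monitors x y e) : x ≠ y := by
  rintro rfl
  have := h .nil ⟨.nil, fun q _ => by simp [weight]⟩
  simp at this

end GMEG

/-! ### The approximation algorithm as a program -/

namespace RAM

open Classical in
/-- The truth value of a proposition. -/
noncomputable def ind (p : Prop) : ℕ := if p then 1 else 0

theorem ind_true {p : Prop} (h : p) : ind p = 1 := by simp [ind, h]

theorem ind_false {p : Prop} (h : ¬ p) : ind p = 0 := by simp [ind, h]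

theorem ind_ne_zero {p : Prop} : ind p ≠ 0 ↔ p := by
  by_cases h : p <;> simp [ind, h]

theorem ind_congr {p q : Prop} (h : p ↔ q) : ind p = ind q := by rw [propext h]

/-! ### Folds as sums, products, quantifiers and extrema -/

@[simp] theorem Op.apply_add (a b : ℕ) : Op.add.apply a b = a + b := rfl
@[simp] theorem Op.apply_sub (a b : ℕ) : Op.sub.apply a b = a - b := rfl
@[simp] theorem Op.apply_mul (a b : ℕ) : Op.mul.apply a b = a * b := rfl
@[simp] theorem Op.apply_div (a b : ℕ) : Op.div.apply a b = a / b := rfl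

@[simp] theorem Op.apply_max (a b : ℕ) : Op.max.apply a b = Max.max a b := by
  simp only [Op.apply]; omega

@[simp] theorem Op.apply_min (a b : ℕ) : Op.min.apply a b = Min.min a b := by
  simp only [Op.apply]; omega

theorem max_ind (p q : Prop) : max (ind p) (ind q) = ind (p ∨ q) := by
  by_cases hp : p <;> by_cases hq : q <;> simp [ind, hp, hq]

theorem min_ind (p q : Prop) : min (ind p) (ind q) = ind (p ∧ q) := by
  by_cases hp : p <;> by_cases hq : q <;> simp [ind, hp, hq]

theorem one_sub_ind (p : Prop) : 1 - ind p = ind (¬ p) := by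
  by_cases hp : p <;> simp [ind, hp]

theorem Op.fold_add_eq (v : ℕ → ℕ) (n : ℕ) : Op.add.fold 0 v n = ∑ i : Fin n, v i := by
  induction n with
  | zero => rfl
  | succ n ih => rw [Op.fold, ih, Fin.sum_univ_castSucc]; rfl

theorem Op.fold_mul_eq (v : ℕ → ℕ) (n : ℕ) : Op.mul.fold 1 v n = ∏ i : Fin n, v i := by
  induction n with
  | zero => rfl
  | succ n ih => rw [Op.fold, ih, Fin.prod_univ_castSucc]; rfl

theorem Op.fold_max_ind {v : ℕ → ℕ} {n : ℕ} (p : Fin n → Prop) (h : ∀ i : Fin n, v i = ind (p i)) :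
    Op.max.fold 0 v n = ind (∃ i, p i) := by
  induction n with
  | zero => exact (ind_false (by simp)).symm
  | succ n ih =>
    rw [Op.fold, ih (fun i => p i.castSucc) (fun i => h i.castSucc), Op.apply_max,
      show v n = ind (p (Fin.last n)) from h (Fin.last n), max_ind]
    refine ind_congr ⟨?_, ?_⟩
    · rintro (⟨i, hi⟩ | hi)
      exacts [⟨_, hi⟩, ⟨_, hi⟩]
    · rintro ⟨i, hi⟩
      induction i using Fin.lastCases with
      | last => exact .inr hi
      | cast i => exact .inl ⟨i, hi⟩

theorem Op.le_fold_max (a : ℕ) (v : ℕ → ℕ) (n : ℕ) : a ≤ Op.max.fold a v n ∧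
    (∀ i < n, v i ≤ Op.max.fold a v n) ∧
    (Op.max.fold a v n = a ∨ ∃ i < n, Op.max.fold a v n = v i) := by
  induction n with
  | zero => exact ⟨le_rfl, by simp, .inl rfl⟩
  | succ n ih =>
    obtain ⟨h1, h2, h3⟩ := ih
    rw [Op.fold, Op.apply_max]
    refine ⟨h1.trans (le_max_left _ _), fun i hi => ?_, ?_⟩
    · rcases Nat.lt_succ_iff_lt_or_eq.1 hi with h | rfl
      · exact (h2 i h).trans (le_max_left _ _)
      · exact le_max_right _ _
    · rcases le_total (v n) (Op.max.fold a v n) with h | h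
      · rw [max_eq_left h]
        rcases h3 with h3 | ⟨i, hi, h3⟩
        · exact .inl h3
        · exact .inr ⟨i, by omega, h3⟩
      · rw [max_eq_right h]
        exact .inr ⟨n, by omega, rfl⟩

theorem Op.fold_min_le (a : ℕ) (v : ℕ → ℕ) (n : ℕ) : Op.min.fold a v n ≤ a ∧
    (∀ i < n, Op.min.fold a v n ≤ v i) ∧
    (Op.min.fold a v n = a ∨ ∃ i < n, Op.min.fold a v n = v i) := by
  induction n with
  | zero => exact ⟨le_rfl, by simp, .inl rfl⟩
  | succ n ih =>
    obtain ⟨h1, h2, h3⟩ := ih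
    rw [Op.fold, Op.apply_min]
    refine ⟨(min_le_left _ _).trans h1, fun i hi => ?_, ?_⟩
    · rcases Nat.lt_succ_iff_lt_or_eq.1 hi with h | rfl
      · exact (min_le_left _ _).trans (h2 i h)
      · exact min_le_right _ _
    · rcases le_total (v n) (Op.min.fold a v n) with h | h
      · rw [min_eq_right h]
        exact .inr ⟨n, by omega, rfl⟩
      · rw [min_eq_left h]
        rcases h3 with h3 | ⟨i, hi, h3⟩
        · exact .inl h3
        · exact .inr ⟨i, by omega, h3⟩

/-- Terms that do not read array `a`. -/
def Term.avoids (a : ℕ) : Term → Bool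
  | .lit _ => true
  | .var _ => true
  | .get b i => decide (b ≠ a) && i.avoids a
  | .bin _ e f => e.avoids a && f.avoids a
  | .fold _ e f => e.avoids a && f.avoids a

theorem Term.eval_congr {a n : ℕ} {σ τ : Store} (h : ∀ b, b ≠ a → σ b = τ b) (e : Term) :
    e.avoids a = true → ∀ l ρ, e.eval n σ l ρ = e.eval n τ l ρ := by
  induction e with
  | lit => intros; rfl
  | var => intros; rfl
  | get b i ih =>
    intro he l ρ
    simp only [Term.avoids, Bool.and_eq_true, decide_eq_true_eq] at he
    simp only [Term.eval, ih he.2, h b he.1]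
  | bin o e f ihe ihf =>
    intro he l ρ
    simp only [Term.avoids, Bool.and_eq_true] at he
    simp only [Term.eval, ihe he.1, ihf he.2]
  | fold o e f ihe ihf =>
    intro he l ρ
    simp only [Term.avoids, Bool.and_eq_true] at he
    simp only [Term.eval, ihe he.1, ihf he.2]

theorem exec_tab_of_ne {n k a b : ℕ} {e : Term} {σ : Store} (h : b ≠ a) :
    (Cmd.tab k a e).exec n σ b = σ b := tabulate_of_ne h _

/-- An in-place tabulation could read entries it has just overwritten. This is excluded for terms
that avoid the array; therefore the updates of arrays `12` and `13` pass through the buffers `16`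
and `15`. -/
theorem exec_tab {n k a : ℕ} {e : Term} (h : e.avoids a = true) {σ : Store} {m : ℕ}
    (hm : m < n ^ k) : (Cmd.tab k a e).exec n σ a m = e.eval n σ 1 (env1 m) := by
  have key : ∀ j, tabulate n a e σ j a m = if m < j then e.eval n σ 1 (env1 m) else σ a m := by
    intro j
    induction j with
    | zero => simp [tabulate]
    | succ j ih =>
      rw [tabulate, Store.write_apply, ih]
      by_cases hmj : m = j
      · subst hmj
        rw [if_pos ⟨rfl, rfl⟩, if_pos (Nat.lt_succ_self _)]
        exact e.eval_congr (fun b hb => tabulate_of_ne hb _) h _ _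
      · rw [if_neg (by tauto)]
        exact if_congr (by omega) rfl rfl
  exact (key _).trans (if_pos hm)

/-! #### Building blocks -/

namespace Term

/-- The loop bound. -/
def bound : Term := get 6 (lit 0)

/-- The index of a matrix entry. -/
def idx (u v : Term) : Term := bin .add (bin .mul u bound) v

/-- The remainder modulo the loop bound. -/
def modBound (m : Term) : Term := bin .sub m (bin .mul (bin .div m bound) bound)

/-- The remainder modulo two. -/
def parity (m : Term) : Term := bin .sub m (bin .mul (bin .div m (lit 2)) (lit 2))

/-- Negation of a truth value. -/
def not (e : Term) : Term := bin .sub (lit 1) e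

/-- Equality of numbers. -/
def eq (e f : Term) : Term := not (bin .add (bin .sub e f) (bin .sub f e))

variable {n l : ℕ} {σ : Store} {ρ : ℕ → ℕ}

theorem eval_bound (h : σ 6 0 = n) : bound.eval n σ l ρ = n := h

theorem eval_idx (h : σ 6 0 = n) (u v : Term) :
    (idx u v).eval n σ l ρ = u.eval n σ l ρ * n + v.eval n σ l ρ := by
  simp only [idx, eval, eval_bound h, Op.apply_add, Op.apply_mul]

theorem eval_modBound (h : σ 6 0 = n) (m : Term) :
    (modBound m).eval n σ l ρ = m.eval n σ l ρ % n := by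
  simp only [modBound, eval, eval_bound h, Op.apply_sub, Op.apply_mul, Op.apply_div]
  have := Nat.div_add_mod' (m.eval n σ l ρ) n
  omega

theorem eval_parity (m : Term) : (parity m).eval n σ l ρ = m.eval n σ l ρ % 2 := by
  simp only [parity, eval, Op.apply_sub, Op.apply_mul, Op.apply_div]
  omega

theorem eval_not (e : Term) : e.not.eval n σ l ρ = 1 - e.eval n σ l ρ := rfl

theorem eval_eq (e f : Term) : (eq e f).eval n σ l ρ = ind (e.eval n σ l ρ = f.eval n σ l ρ) := by
  simp only [eq, eval_not, eval, Op.apply_sub, Op.apply_add]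
  by_cases h : e.eval n σ l ρ = f.eval n σ l ρ
  · rw [ind_true h, h]; omega
  · rw [ind_false h]; omega

end Term

/-! ### Row-by-row indices and their inversion -/

theorem idx_div {n u v : ℕ} (hv : v < n) : (u * n + v) / n = u := by
  rw [mul_comm, Nat.mul_add_div (by omega), Nat.div_eq_of_lt hv, add_zero]

theorem idx_mod {n u v : ℕ} (hv : v < n) : (u * n + v) % n = v := by
  rw [mul_comm, Nat.mul_add_mod, Nat.mod_eq_of_lt hv]

theorem idx_lt {n k u v : ℕ} (hu : u < n ^ k) (hv : v < n) : u * n + v < n ^ (k + 1) := by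
  have : (u + 1) * n ≤ n ^ k * n := Nat.mul_le_mul_right _ hu
  rw [pow_succ]; rw [Nat.succ_mul] at this; omega

theorem idx_inj {n u v u' v' : ℕ} (hv : v < n) (hv' : v' < n) :
    u * n + v = u' * n + v' ↔ u = u' ∧ v = v' := by
  refine ⟨fun h => ⟨?_, ?_⟩, fun h => by rw [h.1, h.2]⟩
  · rw [← idx_div (u := u) hv, h, idx_div hv']
  · rw [← idx_mod (u := u) hv, h, idx_mod hv']

/-- The index of an entry of a table with four coordinates. -/
def flat {n : ℕ} (a b x y : Fin n) : ℕ := ((a * n + b) * n + x) * n + y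

theorem flat_lt {n : ℕ} (a b x y : Fin n) : flat a b x y < n ^ 4 :=
  idx_lt (idx_lt (idx_lt (k := 1) (by simp) b.isLt) x.isLt) y.isLt

/-! #### The program -/

/-- The arrays of numerators, denominators and targets, and the vertex costs; `g` distinguishes the
two problems. -/
def numArray (g : Bool) : ℕ := bif g then 2 else 1
/-- See `numArray`. -/
def denArray (g : Bool) : ℕ := bif g then 3 else 1
/-- See `numArray`. -/
def targetArray (g : Bool) : ℕ := bif g then 4 else 1
/-- See `numArray`. -/
def costTerm (g : Bool) : Term := bif g then .get 5 (.var 0) else .lit 1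

open Term

/-- A common denominator. -/
def denominatorCmd (g : Bool) : Cmd := .tab 0 9 (fold .mul (lit 1) (fold .mul (lit 1)
  (bin .max (lit 1) (get (denArray g) (idx (var 1) (var 2))))))

/-- The doubled integral weights. -/
def weightCmd (g : Bool) : Cmd := .tab 2 10 (bin .mul (bin .mul
  (bin .div (get 9 (lit 0)) (get (denArray g) (var 0))) (get (numArray g) (var 0))) (lit 2))

/-- A bound on all distances. -/
def infCmd : Cmd := .tab 0 11 (bin .mul (bin .add (fold .add (lit 0) (fold .add (lit 0)
  (get 10 (idx (var 1) (var 2))))) (lit 1)) bound)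

/-- The initial distance tables, one for each pair of vertices. -/
def initCmd : Cmd := .tab 4 12 (bin .mul (get 11 (lit 0))
  (eq (modBound (bin .div (var 0) bound)) (modBound (var 0))).not)

/-- The two coordinates of a table index that select the table, as the index of a matrix entry. -/
def tableTerm : Term := bin .div (bin .div (var 0) bound) bound

/-- The source coordinate of a table index. -/
def sourceTerm : Term := modBound (bin .div (var 0) bound)

/-- The weight of the pair of the source and the vertex `var 1`. -/
def stepTerm : Term := bin .add (bin .add (get 10 (idx sourceTerm (var 1)))
    (bin .max (eq tableTerm (idx sourceTerm (var 1))) (eq tableTerm (idx (var 1) sourceTerm))))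
  (bin .mul (get 11 (lit 0)) (get 1 (idx sourceTerm (var 1))).not)

/-- One round of the Bellman-Ford algorithm. -/
def roundCmd : Cmd := .seq (.tab 4 16 (fold .min (get 12 (var 0))
    (bin .add (get 12 (idx (idx tableTerm (var 1)) (modBound (var 0)))) stepTerm)))
  (.tab 4 12 (get 16 (var 0)))

/-- Whether the pair `(a, b)` is monitored by two vertices of the set with indicator `S`. -/
def coveredTerm (S : Term → Term) (a b : Term) (l : ℕ) : Term :=
  fold .max (lit 0) (fold .max (lit 0) (bin .min (bin .min (S (var l)) (S (var (l + 1))))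
    (parity (get 12 (idx (idx (idx a b) (var l)) (var (l + 1)))))))

/-- The number of targets covered by the set with indicator `S`. -/
def countTerm (g : Bool) (S : Term → Term) (l : ℕ) : Term :=
  fold .add (lit 0) (fold .add (lit 0) (bin .min (get (targetArray g) (idx (var l) (var (l + 1))))
    (coveredTerm S (var l) (var (l + 1)) (l + 2))))

/-- The current solution together with two vertices. -/
def extendTerm (p q v : Term) : Term := bin .max (get 13 v) (bin .max (eq v p) (eq v q))

/-- The number of targets that are not covered by the current solution. -/
def restCmd (g : Bool) : Cmd := .tab 0 17 (bin .sub
  (fold .add (lit 0) (fold .add (lit 0) (get (targetArray g) (idx (var 1) (var 2)))))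
  (countTerm g (get 13) 1))

/-- The best pair of vertices, encoded together with the number of targets covered. -/
def bestCmd (g : Bool) : Cmd := .tab 0 14 (fold .max (lit 0) (fold .max (lit 0)
  (idx (idx (countTerm g (extendTerm (var 1) (var 2)) 3) (var 1)) (var 2))))

/-- The next solution. -/
def nextCmd : Cmd := .seq (.tab 1 15 (bin .max (get 13 (var 0)) (bin .min (get 17 (lit 0))
    (bin .max (eq (var 0) (modBound (bin .div (get 14 (lit 0)) bound)))
      (eq (var 0) (modBound (get 14 (lit 0))))))))
  (.tab 1 13 (get 15 (var 0)))

/-- One step of the greedy algorithm. -/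
def greedyCmd (g : Bool) : Cmd := .seq (restCmd g) (.seq (bestCmd g) nextCmd)

/-- The approximation algorithm. -/
def mainCmd (g : Bool) : Cmd :=
  .seq (.seq (denominatorCmd g) (.seq (weightCmd g) infCmd))
    (.seq (.seq initCmd (.iter 1 roundCmd))
      (.seq (.seq (.tab 1 13 (costTerm g).not) (.iter 2 (greedyCmd g)))
        (.tab 1 0 (get 13 (var 0)))))

theorem mainCmd_WF (g : Bool) : (mainCmd g).WF = true := by cases g <;> rfl

/-! ### Correctness of the weights and of the distance tables -/

open Term GMEG

/-- The input arrays hold the instance `I`. -/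
structure Represents (g : Bool) (I : GMEG) (σ : Store) : Prop where
  bound : σ 6 0 = I.n
  adj : ∀ u v : Fin I.n, σ 1 (u * I.n + v) = ind (I.G.Adj u v)
  num : ∀ u v : Fin I.n, I.G.Adj u v → σ (numArray g) (u * I.n + v) = (I.w s(u, v)).num
  den : ∀ u v : Fin I.n, I.G.Adj u v → σ (denArray g) (u * I.n + v) = (I.w s(u, v)).den
  target : ∀ u v : Fin I.n, σ (targetArray g) (u * I.n + v) = ind (s(u, v) ∈ I.targets)
  cost : ∀ v : Fin I.n, (costTerm g).eval I.n σ 1 (env1 v) = I.c v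

variable {g : Bool} {I : GMEG} {σ τ : Store}

theorem Represents.congr (h : Represents g I σ) (hτ : ∀ a, 1 ≤ a → a ≤ 6 → τ a = σ a) :
    Represents g I τ where
  bound := by rw [hτ 6 (by omega) (by omega), h.bound]
  adj := by rw [hτ 1 (by omega) (by omega)]; exact h.adj
  num := by rw [hτ _ (by cases g <;> decide) (by cases g <;> decide)]; exact h.num
  den := by rw [hτ _ (by cases g <;> decide) (by cases g <;> decide)]; exact h.den
  target := by rw [hτ _ (by cases g <;> decide) (by cases g <;> decide)]; exact h.target
  cost := by
    have h1 := h.cost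
    cases g
    · exact h1
    · intro v
      have := h1 v
      simp only [costTerm, cond_true, Term.eval] at this ⊢
      rw [hτ 5 (by omega) (by omega), this]

theorem Represents.exec (h : Represents g I σ) {p : Cmd} (hp : p.WF = true) :
    Represents g I (p.exec I.n σ) :=
  h.congr fun a h1 h2 => p.exec_input hp I.n σ h1 (by omega)

/-- The integral edge weights for a common denominator. -/
def intWeight (I : GMEG) (Δ : ℕ) (e : Sym2 (Fin I.n)) : ℕ := (Δ / (I.w e).den) * (I.w e).num

theorem intWeight_cast {Δ : ℕ} {e : Sym2 (Fin I.n)} (h : (I.w e).den ∣ Δ) :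
    (intWeight I Δ e : ℚ≥0) = Δ * I.w e := by
  obtain ⟨d, rfl⟩ := h
  have hpos : 0 < (I.w e).den := (I.w e).den_pos
  rw [intWeight, Nat.mul_div_cancel_left _ hpos]
  have h1 : ((I.w e).den : ℚ≥0) * I.w e = (I.w e).num := NNRat.den_mul_eq_num _
  push_cast
  rw [← h1]; ring

/-- The arrays hold the doubled integral weights and a bound on all distances. -/
structure Weighted (I : GMEG) (Δ S : ℕ) (σ : Store) : Prop where
  pos : 0 < Δ
  dvd : ∀ e ∈ I.G.edgeSet, (I.w e).den ∣ Δ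
  weight : ∀ u v : Fin I.n, I.G.Adj u v → σ 10 (u * I.n + v) = 2 * intWeight I Δ s(u, v)
  le : ∀ e ∈ I.G.edgeSet, 2 * intWeight I Δ e ≤ S
  inf : σ 11 0 = (S + 1) * I.n

theorem Weighted.congr {Δ S : ℕ} (h : Weighted I Δ S σ) (h1 : τ 10 = σ 10) (h2 : τ 11 = σ 11) :
    Weighted I Δ S τ :=
  ⟨h.pos, h.dvd, by rw [h1]; exact h.weight, h.le, by rw [h2]; exact h.inf⟩

theorem idx_lt_sq {n : ℕ} (u v : Fin n) : (u * n + v : ℕ) < n ^ 2 :=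
  idx_lt (k := 1) (by simp) v.isLt

theorem eval_pair_sum {n a : ℕ} (h : σ 6 0 = n) (m : ℕ) :
    (fold .add (lit 0) (fold .add (lit 0) (get a (idx (var 1) (var 2))))).eval n σ 1 (env1 m) =
      ∑ u : Fin n, ∑ v : Fin n, σ a (u * n + v) := by
  simp only [Term.eval, Op.fold_add_eq, eval_idx h, Function.update_apply]
  simp

theorem exec_denominatorCmd (h : Represents g I σ) :
    (denominatorCmd g).exec I.n σ 9 0 =
      ∏ u : Fin I.n, ∏ v : Fin I.n, max 1 (σ (denArray g) (u * I.n + v)) := by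
  rw [denominatorCmd, exec_tab (by cases g <;> rfl) (by simp)]
  simp only [Term.eval, Op.fold_mul_eq, eval_idx h.bound, Function.update_apply, Op.apply_max]
  simp

theorem exec_preparation (h : Represents g I σ) : ∃ Δ S, Weighted I Δ S
    ((Cmd.seq (denominatorCmd g) (.seq (weightCmd g) infCmd)).exec I.n σ) := by
  have hΔ := exec_denominatorCmd h
  set Δ := ∏ u : Fin I.n, ∏ v : Fin I.n, max 1 (σ (denArray g) (u * I.n + v)) with hΔdef
  set σ₁ := (denominatorCmd g).exec I.n σ with hσ₁
  have hr₁ : Represents g I σ₁ := h.exec (by cases g <;> rfl)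
  set σ₂ := (weightCmd g).exec I.n σ₁ with hσ₂
  have hr₂ : Represents g I σ₂ := hr₁.exec (by cases g <;> rfl)
  have hw : ∀ u v : Fin I.n, I.G.Adj u v → σ₂ 10 (u * I.n + v) = 2 * intWeight I Δ s(u, v) := by
    intro u v huv
    rw [hσ₂, weightCmd, exec_tab (by cases g <;> rfl) (idx_lt_sq u v)]
    simp only [Term.eval, env1, Function.update_self, Op.apply_mul, Op.apply_div, hΔ,
      hr₁.den u v huv, hr₁.num u v huv, intWeight]
    ring
  -- The sum runs over the whole matrix, including the irrelevant entries at non-edges; it only has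
  -- to dominate every single doubled weight. Likewise the maximum with `1` changes no denominator
  -- of an edge and keeps the product positive.
  refine ⟨Δ, ∑ u : Fin I.n, ∑ v : Fin I.n, σ₂ 10 (u * I.n + v), ?_, ?_, ?_, ?_, ?_⟩
  · exact Finset.prod_pos fun u _ => Finset.prod_pos fun v _ => by omega
  · intro e he
    induction e using Sym2.ind with
    | _ u v =>
      have h1 := h.den u v he
      have h2 : (I.w s(u, v)).den = max 1 (σ (denArray g) (u * I.n + v)) := by
        rw [h1]
        have := (I.w s(u, v)).den_pos
        omega
      rw [h2]
      exact (Finset.dvd_prod_of_mem (fun v : Fin I.n => max 1 (σ (denArray g) (u * I.n + v)))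
        (Finset.mem_univ v)).trans (Finset.dvd_prod_of_mem
          (fun u : Fin I.n => ∏ v : Fin I.n, max 1 (σ (denArray g) (u * I.n + v)))
          (Finset.mem_univ u))
  · intro u v huv
    rw [← hw u v huv]
    exact congrFun (exec_tab_of_ne (by omega)) _
  · intro e he
    induction e using Sym2.ind with
    | _ u v =>
      rw [← hw u v he]
      exact (Finset.single_le_sum (f := fun v : Fin I.n => σ₂ 10 (u * I.n + v))
        (fun _ _ => Nat.zero_le _) (Finset.mem_univ v)).trans
        (Finset.single_le_sum (f := fun u : Fin I.n => ∑ v : Fin I.n, σ₂ 10 (u * I.n + v))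
        (fun _ _ => Nat.zero_le _) (Finset.mem_univ u))
  · change infCmd.exec I.n σ₂ 11 0 = _
    rw [infCmd, exec_tab rfl (by simp)]
    have h1 : ∀ e f : Term, (bin .mul (bin .add e (lit 1)) f).eval I.n σ₂ 1 (env1 0) =
      (e.eval I.n σ₂ 1 (env1 0) + 1) * f.eval I.n σ₂ 1 (env1 0) := fun _ _ => rfl
    rw [h1, eval_pair_sum hr₂.bound, eval_bound hr₂.bound]

/-- Table `(a, b)` holds the distances after `k` rounds. -/
def Rounds (I : GMEG) (Δ S k : ℕ) (σ : Store) : Prop :=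
  ∀ a b : Fin I.n, IsRound (intWeight I Δ) s(a, b) ((S + 1) * I.n) k fun x y => σ 12 (flat a b x y)

theorem flat_mod {n : ℕ} (a b x y : Fin n) : flat a b x y % n = y := idx_mod y.isLt

theorem flat_div {n : ℕ} (a b x y : Fin n) : flat a b x y / n = (a * n + b) * n + x :=
  idx_div y.isLt

theorem exec_initCmd {Δ S : ℕ} (h : Represents g I σ) (hw : Weighted I Δ S σ) :
    Rounds I Δ S 0 (initCmd.exec I.n σ) := by
  have key : ∀ a b x y : Fin I.n, initCmd.exec I.n σ 12 (flat a b x y) =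
      (S + 1) * I.n * (1 - ind ((x : ℕ) = y)) := by
    intro a b x y
    rw [initCmd, exec_tab rfl (flat_lt a b x y)]
    simp only [Term.eval, env1, Function.update_self, Op.apply_mul, Op.apply_div, hw.inf, eval_not,
      eval_eq, eval_modBound h.bound, eval_bound h.bound, flat_mod, flat_div, idx_mod x.isLt]
  intro a b
  refine isRound_zero (fun x => ?_) fun x y hxy => ?_
  · simp only [key, ind_true]; simp
  · simp only [key]
    rw [ind_false (fun h => hxy (Fin.ext h))]; simp

theorem sym2_eq_iff {n : ℕ} (a b x z : Fin n) : s(x, z) = s(a, b) ↔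
    (a * n + b : ℕ) = x * n + z ∨ (a * n + b : ℕ) = z * n + x := by
  rw [Sym2.eq_iff, idx_inj b.isLt z.isLt, idx_inj b.isLt x.isLt]
  simp only [← Fin.ext_iff]
  constructor
  · rintro (⟨rfl, rfl⟩ | ⟨rfl, rfl⟩) <;> simp
  · rintro (⟨rfl, rfl⟩ | ⟨rfl, rfl⟩) <;> simp

/-- Whatever array `10` holds at a non-edge, the added copy of `(S + 1) * n` lifts the step weight
to infinity, as `IsRound.succ` requires. -/
theorem exec_roundCmd {Δ S k : ℕ} (h : Represents g I σ) (hw : Weighted I Δ S σ)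
    (hk : Rounds I Δ S k σ) : Rounds I Δ S (k + 1) (roundCmd.exec I.n σ) := by
  intro a b
  set W : Fin I.n → Fin I.n → ℕ := fun x z => σ 10 (x * I.n + z) + ind (s(x, z) = s(a, b)) +
    (S + 1) * I.n * ind (¬ I.G.Adj x z) with hW
  have key : ∀ x y : Fin I.n, roundCmd.exec I.n σ 12 (flat a b x y) =
      Op.min.fold (σ 12 (flat a b x y)) (fun z => σ 12 (((a * I.n + b) * I.n + z) * I.n + y) +
        (σ 10 (x * I.n + z) + max (ind ((a * I.n + b : ℕ) = x * I.n + z))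
          (ind ((a * I.n + b : ℕ) = z * I.n + x)) + (S + 1) * I.n * (1 - σ 1 (x * I.n + z))))
        I.n := by
    intro x y
    rw [roundCmd, Cmd.exec, exec_tab rfl (flat_lt a b x y)]
    simp only [Term.eval, env1, Function.update_self]
    rw [exec_tab rfl (flat_lt a b x y)]
    simp only [Term.eval, env1, Function.update_self, tableTerm, sourceTerm, stepTerm, Op.apply_mul,
      Op.apply_div, Op.apply_add, Op.apply_max, hw.inf, eval_not, eval_idx h.bound, eval_eq,
      eval_modBound h.bound, eval_bound h.bound, Function.update_apply]
    simp [flat_mod, flat_div, idx_mod x.isLt, idx_div x.isLt]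
  have key' : ∀ x y z : Fin I.n, σ 12 (((a * I.n + b) * I.n + z) * I.n + y) +
        (σ 10 (x * I.n + z) + max (ind ((a * I.n + b : ℕ) = x * I.n + z))
          (ind ((a * I.n + b : ℕ) = z * I.n + x)) + (S + 1) * I.n * (1 - σ 1 (x * I.n + z))) =
      σ 12 (flat a b z y) + W x z := by
    intro x y z
    rw [h.adj, one_sub_ind, max_ind, ← ind_congr (sym2_eq_iff a b x z)]
    rfl
  refine (hk a b).succ (W := W) ?_ ?_ ?_ ?_ ?_
  · intro x z hxz
    simp only [hW, hw.weight x z hxz, perturbed, ind]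
    simp [hxz]
  · intro x z hxz
    simp only [hW, ind_true hxz]; omega
  · intro x y
    simp only [key]
    exact (Op.fold_min_le _ _ _).1
  · intro x y z
    simp only [key]
    rw [← key']
    exact (Op.fold_min_le _ _ _).2.1 z z.isLt
  · intro x y
    simp only [key]
    rcases (Op.fold_min_le (σ 12 (flat a b x y)) (fun z =>
        σ 12 (((a * I.n + b) * I.n + z) * I.n + y) +
        (σ 10 (x * I.n + z) + max (ind ((a * I.n + b : ℕ) = x * I.n + z))
          (ind ((a * I.n + b : ℕ) = z * I.n + x)) + (S + 1) * I.n * (1 - σ 1 (x * I.n + z))))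
      I.n).2.2 with h1 | ⟨z, hz, h1⟩
    · exact .inl h1
    · refine .inr ⟨⟨z, hz⟩, ?_⟩
      rw [h1]
      exact key' x y ⟨z, hz⟩

/-- The distance tables tell which pairs monitor which edges. -/
def Tables (I : GMEG) (σ : Store) : Prop :=
  ∀ a b x y : Fin I.n, σ 12 (flat a b x y) % 2 = ind (I.Monitors x y s(a, b))

theorem exec_distances {Δ S : ℕ} (h : Represents g I σ) (hw : Weighted I Δ S σ) :
    Tables I ((Cmd.seq initCmd (.iter 1 roundCmd)).exec I.n σ) := by
  have key : ∀ k, Represents g I ((roundCmd.exec I.n)^[k] (initCmd.exec I.n σ)) ∧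
      Weighted I Δ S ((roundCmd.exec I.n)^[k] (initCmd.exec I.n σ)) ∧
      Rounds I Δ S k ((roundCmd.exec I.n)^[k] (initCmd.exec I.n σ)) := by
    intro k
    induction k with
    | zero =>
      exact ⟨h.exec rfl, hw.congr (exec_tab_of_ne (by omega)) (exec_tab_of_ne (by omega)),
        exec_initCmd h hw⟩
    | succ k ih =>
      rw [Function.iterate_succ_apply']
      obtain ⟨h1, h2, h3⟩ := ih
      refine ⟨h1.exec rfl, h2.congr ?_ ?_, exec_roundCmd h1 h2 h3⟩ <;>
      · rw [roundCmd, Cmd.exec, exec_tab_of_ne (by omega), exec_tab_of_ne (by omega)]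
  obtain ⟨-, h2, h3⟩ := key I.n
  intro a b x y
  have h4 := odd_iff_monitors h2.pos (fun e he => intWeight_cast (h2.dvd e he)) h2.le (h3 a b) x y
  simp only [Cmd.exec, pow_one]
  by_cases hm : I.Monitors x y s(a, b)
  · rw [ind_true hm]; exact h4.2 hm
  · rw [ind_false hm]
    have := mt h4.1 hm
    omega

/-! ### Correctness of the greedy iteration -/

open Greedy

open Classical in
/-- The targets, as ordered pairs. -/
noncomputable def targetPairs (I : GMEG) : Finset (Fin I.n × Fin I.n) :=
  Finset.univ.filter fun e => s(e.1, e.2) ∈ I.targets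

/-- The pair `e` is monitored by `x` and `y`. -/
def PairMonitors (I : GMEG) (e : Fin I.n × Fin I.n) (x y : Fin I.n) : Prop :=
  I.Monitors x y s(e.1, e.2)

/-- Each target edge is represented by both of its orientations, which is harmless for covering. The
distinctness of the monitoring vertices is automatic by `Monitors.ne`. -/
theorem isSolution_iff (M : Finset (Fin I.n)) :
    I.IsSolution M ↔ ∀ e ∈ targetPairs I, Covers (PairMonitors I) M e := by
  constructor
  · rintro h ⟨a, b⟩ he
    obtain ⟨x, hx, y, hy, -, hxy⟩ := h s(a, b) (by simpa [targetPairs] using he)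
    exact ⟨x, hx, y, hy, hxy⟩
  · intro h e he
    induction e using Sym2.ind with
    | _ a b =>
      obtain ⟨x, hx, y, hy, hxy⟩ := h (a, b) (by simpa [targetPairs] using he)
      exact ⟨x, hx, y, hy, Monitors.ne hxy, hxy⟩

theorem card_filter_eq_sum_ind {n : ℕ} (p : Fin n × Fin n → Prop) [DecidablePred p] :
    (Finset.univ.filter p).card = ∑ a : Fin n, ∑ b : Fin n, ind (p (a, b)) := by
  rw [Finset.card_filter, Fintype.sum_prod_type]
  refine Finset.sum_congr rfl fun a _ => Finset.sum_congr rfl fun b _ => ?_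
  by_cases h : p (a, b) <;> simp [ind, h]

theorem cov_eq_filter (M : Finset (Fin I.n)) [DecidablePred fun e : Fin I.n × Fin I.n =>
      s(e.1, e.2) ∈ I.targets ∧ Covers (PairMonitors I) M e] :
    cov (targetPairs I) (PairMonitors I) M = Finset.univ.filter fun e =>
      s(e.1, e.2) ∈ I.targets ∧ Covers (PairMonitors I) M e := by
  ext e
  simp [mem_cov, targetPairs]

/-- The indicator `S` is needed only at the two innermost loop variables, so the same count serves
the current solution and its extensions by a pair. -/
theorem eval_countTerm (h : Represents g I σ) (ht : Tables I σ) (S : Term → Term) (l : ℕ)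
    (ρ : ℕ → ℕ) (M : Finset (Fin I.n)) (hS : ∀ a b x y : Fin I.n, ∀ ρ',
      ρ' = Function.update (Function.update (Function.update (Function.update ρ l a)
        (l + 1) b) (l + 2) x) (l + 3) y →
      (S (var (l + 2))).eval I.n σ (l + 4) ρ' = ind (x ∈ M) ∧
      (S (var (l + 3))).eval I.n σ (l + 4) ρ' = ind (y ∈ M)) :
    (countTerm g S l).eval I.n σ l ρ = (cov (targetPairs I) (PairMonitors I) M).card := by
  classical
  rw [cov_eq_filter, card_filter_eq_sum_ind]
  simp only [countTerm, Term.eval, Op.fold_add_eq]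
  refine Finset.sum_congr rfl fun a _ => Finset.sum_congr rfl fun b _ => ?_
  rw [Op.apply_min, ← min_ind]
  congr 1
  · rw [← h.target a b, eval_idx h.bound]
    simp [Term.eval]
  · simp only [coveredTerm, Term.eval]
    rw [Op.fold_max_ind (fun x => ∃ y, (x ∈ M ∧ y ∈ M) ∧ PairMonitors I (a, b) x y)]
    · refine ind_congr ⟨?_, ?_⟩
      · rintro ⟨x, y, ⟨hx, hy⟩, hxy⟩
        exact ⟨x, hx, y, hy, hxy⟩
      · rintro ⟨x, hx, y, hy, hxy⟩
        exact ⟨x, y, ⟨hx, hy⟩, hxy⟩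
    · intro x
      refine Op.fold_max_ind _ fun y => ?_
      obtain ⟨h1, h2⟩ := hS a b x y _ rfl
      rw [Op.apply_min, Op.apply_min, ← min_ind, ← min_ind]
      congr 1
      · exact congrArg₂ min h1 h2
      · rw [eval_parity]
        refine Eq.trans ?_ (ht a b x y)
        simp only [Term.eval, eval_idx h.bound, Function.update_apply, flat]
        simp
        rw [if_neg (by omega), if_neg (by omega)]

/-- The current solution is `M`. -/
def Current (I : GMEG) (M : Finset (Fin I.n)) (σ : Store) : Prop :=
  ∀ v : Fin I.n, σ 13 v = ind (v ∈ M)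

theorem exec_restCmd (h : Represents g I σ) (ht : Tables I σ) {M : Finset (Fin I.n)}
    (hM : Current I M σ) :
    (restCmd g).exec I.n σ 17 0 = rest (targetPairs I) (PairMonitors I) M := by
  classical
  have h1 : (targetPairs I).card = ∑ a : Fin I.n, ∑ b : Fin I.n, ind (s(a, b) ∈ I.targets) :=
    card_filter_eq_sum_ind fun e => s(e.1, e.2) ∈ I.targets
  have h2 := rest_eq (T := targetPairs I) (mon := PairMonitors I) M
  rw [restCmd, exec_tab (by cases g <;> rfl) (by simp)]
  have h3 : ∀ e f : Term, (bin .sub e f).eval I.n σ 1 (env1 0) =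
    e.eval I.n σ 1 (env1 0) - f.eval I.n σ 1 (env1 0) := fun _ _ => rfl
  rw [h3, eval_pair_sum h.bound, eval_countTerm h ht _ _ _ M]
  · simp only [h.target, ← h1]; omega
  · rintro a b x y ρ' rfl
    simp [Term.eval, hM x, hM y]

theorem eval_extendTerm {n l : ℕ} {ρ : ℕ → ℕ} {M : Finset (Fin n)}
    (hM : ∀ v : Fin n, σ 13 v = ind (v ∈ M)) {p q v : Term} {p' q' v' : Fin n}
    (hp : p.eval n σ l ρ = p') (hq : q.eval n σ l ρ = q') (hv : v.eval n σ l ρ = v') :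
    (extendTerm p q v).eval n σ l ρ = ind (v' ∈ M ∪ {p', q'}) := by
  simp only [extendTerm, Term.eval, eval_eq, hp, hq, hv, hM, Op.apply_max, max_ind]
  refine ind_congr ?_
  simp only [Finset.mem_union, Finset.mem_insert, Finset.mem_singleton, Fin.ext_iff]

/-- The count is the leading digit in base `n` of the maximized number, with the pair in the two
last digits; a plain maximum thus also delivers a maximizing pair. -/
theorem exec_bestCmd (h : Represents g I σ) (ht : Tables I σ) {M : Finset (Fin I.n)}
    (hM : Current I M σ) : ∃ p q : Fin I.n,
      (bestCmd g).exec I.n σ 14 0 % I.n = q ∧ (bestCmd g).exec I.n σ 14 0 / I.n % I.n = p ∧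
      ∀ p' q', (cov (targetPairs I) (PairMonitors I) (M ∪ {p', q'})).card ≤
        (cov (targetPairs I) (PairMonitors I) (M ∪ {p, q})).card := by
  set f : ℕ → ℕ → ℕ := fun p q => (idx (idx (countTerm g (extendTerm (var 1) (var 2)) 3) (var 1))
    (var 2)).eval I.n σ 3 (Function.update (Function.update (env1 0) 1 p) 2 q) with hf
  have hf' : ∀ p q : Fin I.n, f p q = ((cov (targetPairs I) (PairMonitors I) (M ∪ {p, q})).card *
      I.n + p) * I.n + q := by
    intro p q
    simp only [hf, eval_idx h.bound]
    rw [eval_countTerm h ht _ _ _ (M ∪ {p, q})]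
    · simp [Term.eval]
    · rintro a b x y ρ' rfl
      constructor <;> apply eval_extendTerm hM <;> simp [Term.eval]
  have hbest : (bestCmd g).exec I.n σ 14 0 =
      Op.max.fold 0 (fun p => Op.max.fold 0 (f p) I.n) I.n := by
    rw [bestCmd, exec_tab (by cases g <;> rfl) (by simp)]
    rfl
  obtain ⟨-, hle, heq⟩ := Op.le_fold_max 0 (fun p => Op.max.fold 0 (f p) I.n) I.n
  rw [← hbest] at hle heq
  set B := (bestCmd g).exec I.n σ 14 0
  have hle' : ∀ p q : Fin I.n, f p q ≤ B := fun p q =>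
    ((Op.le_fold_max 0 (f p) I.n).2.1 q q.isLt).trans (hle p p.isLt)
  have hpos : 0 < I.n := by
    obtain ⟨v⟩ := I.connected.nonempty
    exact v.pos
  obtain ⟨p, q, hpq⟩ : ∃ p q : Fin I.n, B = f p q := by
    -- The maximum may be the starting value `0` of a fold; then all codes are `0`, and the pair
    -- `(0, 0)` attains it.
    have hzero : B = 0 → ∃ p q : Fin I.n, B = f p q := fun h0 =>
      ⟨⟨0, hpos⟩, ⟨0, hpos⟩, by have := hle' ⟨0, hpos⟩ ⟨0, hpos⟩; omega⟩
    rcases heq with h0 | ⟨p, hp, hBp⟩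
    · exact hzero h0
    · rcases (Op.le_fold_max 0 (f p) I.n).2.2 with h0 | ⟨q, hq, hBq⟩
      · exact hzero (hBp.trans h0)
      · exact ⟨⟨p, hp⟩, ⟨q, hq⟩, hBp.trans hBq⟩
  refine ⟨p, q, ?_, ?_, fun p' q' => ?_⟩
  · rw [hpq, hf', idx_mod q.isLt]
  · rw [hpq, hf', idx_div q.isLt, idx_mod p.isLt]
  · have h1 := hle' p' q'
    rw [hpq, hf', hf'] at h1
    have h2 := Nat.div_le_div_right (c := I.n) (Nat.div_le_div_right (c := I.n) h1)
    rwa [idx_div q.isLt, idx_div q'.isLt, idx_div p.isLt, idx_div p'.isLt] at h2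

theorem exec_nextCmd (h : Represents g I σ) {M : Finset (Fin I.n)} (hM : Current I M σ) {r : ℕ}
    (hr : σ 17 0 = r) {p q : Fin I.n} (hp : σ 14 0 / I.n % I.n = p) (hq : σ 14 0 % I.n = q) :
    Current I (if r = 0 then M else M ∪ {p, q}) (nextCmd.exec I.n σ) := by
  intro v
  rw [nextCmd, Cmd.exec, exec_tab rfl (by simp)]
  simp only [Term.eval, env1, Function.update_self]
  rw [exec_tab rfl (by simp)]
  simp only [Term.eval, env1, Function.update_self, eval_eq, eval_modBound h.bound,
    eval_bound h.bound, Op.apply_max, Op.apply_min, Op.apply_div, hr, hM v, max_ind, hp, hq]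
  split_ifs with h0
  · simp [h0]
  -- The minimum with the number of uncovered targets acts as a conditional: it erases the new pair
  -- if nothing is left, and otherwise leaves the indicator unchanged because `r ≥ 1`.
  · rw [show min r (ind ((v : ℕ) = p ∨ (v : ℕ) = q)) = ind ((v : ℕ) = p ∨ (v : ℕ) = q) from
      min_eq_right (by
        by_cases h1 : (v : ℕ) = p ∨ (v : ℕ) = q
        · rw [ind_true h1]; omega
        · rw [ind_false h1]; omega), max_ind]
    refine ind_congr ?_
    simp only [Finset.mem_union, Finset.mem_insert, Finset.mem_singleton, Fin.ext_iff]

theorem exec_greedyCmd (h : Represents g I σ) (ht : Tables I σ) {M : Finset (Fin I.n)}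
    (hM : Current I M σ) : Represents g I ((greedyCmd g).exec I.n σ) ∧
      Tables I ((greedyCmd g).exec I.n σ) ∧ ∃ M', Current I M' ((greedyCmd g).exec I.n σ) ∧
        Step (targetPairs I) (PairMonitors I) M M' := by
  have e1 : ∀ a, a ≠ 17 → (restCmd g).exec I.n σ a = σ a := fun a ha => exec_tab_of_ne ha
  set σ₁ := (restCmd g).exec I.n σ with hσ₁
  have e2 : ∀ a, a ≠ 14 → (bestCmd g).exec I.n σ₁ a = σ₁ a := fun a ha => exec_tab_of_ne ha
  set σ₂ := (bestCmd g).exec I.n σ₁ with hσ₂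
  have hrest : σ₁ 17 0 = _ := exec_restCmd h ht hM
  have hr₁ : Represents g I σ₁ := h.exec (by cases g <;> rfl)
  have ht₁ : Tables I σ₁ := by rw [Tables, e1 12 (by omega)]; exact ht
  have hM₁ : Current I M σ₁ := by rw [Current, e1 13 (by omega)]; exact hM
  have hr₂ : Represents g I σ₂ := hr₁.exec (by cases g <;> rfl)
  have hM₂ : Current I M σ₂ := by rw [Current, e2 13 (by omega)]; exact hM₁
  obtain ⟨p, q, hq, hp, hmax⟩ := exec_bestCmd hr₁ ht₁ hM₁
  refine ⟨h.exec (by cases g <;> rfl), ?_, _, exec_nextCmd hr₂ hM₂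
    (by rw [e2 17 (by omega), hrest]) hp hq, ?_⟩
  · have : (greedyCmd g).exec I.n σ 12 = σ 12 := by
      change nextCmd.exec I.n σ₂ 12 = _
      rw [nextCmd, Cmd.exec, exec_tab_of_ne (by omega), exec_tab_of_ne (by omega), e2 12 (by omega),
        e1 12 (by omega)]
    rw [Tables, this]; exact ht
  · by_cases h0 : rest (targetPairs I) (PairMonitors I) M = 0
    · exact .inl ⟨rest_eq_zero.1 h0, if_pos h0⟩
    · refine .inr ⟨fun h => h0 (rest_eq_zero.2 h), p, q, if_neg h0, ?_⟩
      rw [if_neg h0]; exact hmax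

theorem greedy_iterate (h : Represents g I σ) (ht : Tables I σ) {M : Finset (Fin I.n)}
    (hM : Current I M σ) : ∃ S : ℕ → Finset (Fin I.n), S 0 = M ∧
      (∀ i, Step (targetPairs I) (PairMonitors I) (S i) (S (i + 1))) ∧
      ∀ i, Current I (S i) (((greedyCmd g).exec I.n)^[i] σ) := by
  have key : ∀ i, Represents g I (((greedyCmd g).exec I.n)^[i] σ) ∧
      Tables I (((greedyCmd g).exec I.n)^[i] σ) ∧
      ∃ M', Current I M' (((greedyCmd g).exec I.n)^[i] σ) := by
    intro i
    induction i with
    | zero => exact ⟨h, ht, M, hM⟩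
    | succ i ih =>
      obtain ⟨h1, h2, M', h3⟩ := ih
      rw [Function.iterate_succ_apply']
      obtain ⟨h4, h5, M'', h6, -⟩ := exec_greedyCmd h1 h2 h3
      exact ⟨h4, h5, M'', h6⟩
  -- The store determines the current set, so the sets chosen separately for each `i` agree with
  -- those produced by the steps.
  have huniq : ∀ {M M' : Finset (Fin I.n)} {τ : Store}, Current I M τ →
      Current I M' τ → M = M' := by
    intro M M' τ h1 h2
    ext v
    have := (h1 v).symm.trans (h2 v)
    rw [← ind_ne_zero (p := v ∈ M), this, ind_ne_zero]
  choose S hS using fun i => (key i).2.2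
  refine ⟨S, huniq (hS 0) hM, fun i => ?_, hS⟩
  obtain ⟨-, -, M', h6, h7⟩ := exec_greedyCmd (key i).1 (key i).2.1 (hS i)
  have : S (i + 1) = M' := huniq (hS (i + 1)) (by rw [Function.iterate_succ_apply']; exact h6)
  rw [this]; exact h7

/-- The program computes a GMEG-set of the required cost. -/
theorem mainCmd_spec (h : Represents g I σ) (hex : ∃ M, I.IsSolution M) :
    I.IsSolution (outputSet I.n ((mainCmd g).exec I.n σ)) ∧
      ∀ M, I.IsSolution M → (I.cost (outputSet I.n ((mainCmd g).exec I.n σ)) : ℝ) ≤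
        2 * (I.cost M : ℝ) ^ 2 * Real.log I.n := by
  classical
  obtain ⟨Δ, S, hw⟩ := exec_preparation h
  have hr₁ : Represents g I ((Cmd.seq (denominatorCmd g) (.seq (weightCmd g) infCmd)).exec I.n σ) :=
    h.exec (by cases g <;> rfl)
  set σ₁ := (Cmd.seq (denominatorCmd g) (.seq (weightCmd g) infCmd)).exec I.n σ
  have ht := exec_distances hr₁ hw
  have hr₂ : Represents g I ((Cmd.seq initCmd (.iter 1 roundCmd)).exec I.n σ₁) := hr₁.exec rfl
  set σ₂ := (Cmd.seq initCmd (.iter 1 roundCmd)).exec I.n σ₁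
  have hr₃ : Represents g I ((Cmd.tab 1 13 (costTerm g).not).exec I.n σ₂) :=
    hr₂.exec (by cases g <;> rfl)
  have ht₃ : Tables I ((Cmd.tab 1 13 (costTerm g).not).exec I.n σ₂) := by
    rw [Tables, exec_tab_of_ne (by omega)]; exact ht
  have hM₃ : Current I (Finset.univ.filter fun v => I.c v = 0)
      ((Cmd.tab 1 13 (costTerm g).not).exec I.n σ₂) := by
    intro v
    rw [exec_tab (by cases g <;> rfl) (by simp), eval_not, hr₂.cost v]
    rcases I.binary v with hv | hv <;> simp [ind, hv]
  set σ₃ := (Cmd.tab 1 13 (costTerm g).not).exec I.n σ₂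
  obtain ⟨A, hA0, hstep, hcur⟩ := greedy_iterate hr₃ ht₃ hM₃
  have hout : outputSet I.n ((mainCmd g).exec I.n σ) = A (I.n ^ 2) := by
    ext v
    have h1 : (mainCmd g).exec I.n σ 0 v = ind (v ∈ A (I.n ^ 2)) := by
      rw [← hcur]
      exact exec_tab (n := I.n) (k := 1) (a := 0) (e := get 13 (var 0)) rfl (by simp)
    rw [outputSet, Finset.mem_filter, h1, ind_ne_zero]
    simp
  rw [hout]
  have hmon : ∀ e x y, PairMonitors I e x y → x ≠ y := fun e x y h => Monitors.ne h
  have h0 : ∀ v, v ∈ A 0 ↔ I.c v = 0 := by simp [hA0]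
  refine ⟨?_, fun M hM => ?_⟩
  · obtain ⟨M, hM⟩ := hex
    exact (isSolution_iff _).2 (Greedy.cost_le hmon I.binary A h0 hstep ((isSolution_iff M).1 hM)).1
  · exact (Greedy.cost_le hmon I.binary A h0 hstep ((isSolution_iff M).1 hM)).2

end RAM

/-! ### The two problems -/

namespace RAM

open GMEG

theorem matrixList_getD {n : ℕ} (f : Fin n → Fin n → ℕ) (u v : Fin n) :
    (matrixList f).getD (u * n + v) 0 = f u v := by
  have h1 : (u * n + v : ℕ) < n * n := by rw [← sq]; exact idx_lt_sq u v
  have h2 : (⟨u * n + v, h1⟩ : Fin (n * n)).divNat = u := Fin.ext (idx_div v.isLt)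
  have h3 : (⟨u * n + v, h1⟩ : Fin (n * n)).modNat = v := Fin.ext (idx_mod v.isLt)
  rw [List.getD_eq_getElem _ _ (by simpa [matrixList] using h1)]
  simp only [matrixList, List.getElem_ofFn, h2, h3]

theorem length_le_inputLength {x : List (List ℕ)} {l : List ℕ} (h : l ∈ x) :
    l.length ≤ inputLength x := by
  have h1 : (l.map fun m => Nat.size m + 1).sum ≤ inputLength x :=
    List.single_le_sum (fun _ _ => Nat.zero_le _) _ (List.mem_map.2 ⟨l, h, rfl⟩)
  have h2 := List.length_le_sum_of_one_le (l.map fun m => Nat.size m + 1) (by simp)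
  rw [List.length_map] at h2
  omega

/-- A matrix has `n * n` entries, and each entry contributes at least one to the input length. -/
theorem le_inputLength {n : ℕ} {x : List (List ℕ)} {f : Fin n → Fin n → ℕ}
    (h : matrixList f ∈ x) : n ≤ inputLength x := by
  have h1 := length_le_inputLength h
  rw [matrixList, List.length_ofFn] at h1
  exact (Nat.le_mul_self n).trans h1

theorem represents_input (I : GMEG) : Represents true I ((load I.input).write 6 0 I.n) where
  bound := Store.write_self _ _ _ _
  adj u v := by
    rw [Store.write_of_ne (by omega)]
    simp only [load, GMEG.input, List.getD_cons_succ, List.getD_cons_zero, matrixList_getD]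
    rw [ind]
  num u v h := by
    change (load I.input).write 6 0 I.n 2 _ = _
    rw [Store.write_of_ne (by omega)]
    simp only [load, GMEG.input, List.getD_cons_succ, List.getD_cons_zero, matrixList_getD]
    exact if_pos h
  den u v h := by
    change (load I.input).write 6 0 I.n 3 _ = _
    rw [Store.write_of_ne (by omega)]
    simp only [load, GMEG.input, List.getD_cons_succ, List.getD_cons_zero, matrixList_getD]
    exact if_pos h
  target u v := by
    change (load I.input).write 6 0 I.n 4 _ = _
    rw [Store.write_of_ne (by omega)]
    simp only [load, GMEG.input, List.getD_cons_succ, List.getD_cons_zero, matrixList_getD]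
    rw [ind]
  cost v := by
    have h1 : (List.ofFn I.c).getD v 0 = I.c v := by
      rw [List.getD_eq_getElem _ _ (by simp)]; simp
    simp only [costTerm, cond_true, Term.eval, env1, Function.update_self]
    rw [Store.write_of_ne (by omega), ← h1]
    rfl

end RAM

/-! ### Unit weights and unit costs -/

namespace MEG

/-- The instance of GMEG-Set with unit weights and costs in which all edges are to be monitored. -/
abbrev toGMEG (I : MEG) : GMEG where
  n := I.n
  G := I.G
  connected := I.connected
  w _ := 1
  c _ := 1
  binary _ := .inr rfl
  targets := I.G.edgeSet
  targets_subset := subset_rfl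

theorem toGMEG_weight (I : MEG) {x y : Fin I.n} (p : I.G.Walk x y) :
    I.toGMEG.weight p = p.length := by
  have h : ∀ l : List (Sym2 (Fin I.n)), (l.map fun _ => (1 : ℚ≥0)).sum = l.length := by
    intro l; simp
  exact (h p.edges).trans (by rw [SimpleGraph.Walk.length_edges])

theorem toGMEG_isShortest (I : MEG) {x y : Fin I.n} (p : I.G.Walk x y) :
    I.toGMEG.IsShortest p ↔ p.IsPath ∧ p.length = I.G.dist x y := by
  constructor
  · rintro ⟨hp, hmin⟩
    refine ⟨hp, le_antisymm ?_ (SimpleGraph.dist_le p)⟩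
    obtain ⟨q, hq, hqd⟩ := (I.connected.preconnected x y).exists_path_of_dist
    have h : (p.length : ℚ≥0) ≤ q.length :=
      (I.toGMEG_weight p).symm.trans_le ((hmin q hq).trans_eq (I.toGMEG_weight q))
    rw [Nat.cast_le] at h
    omega
  · rintro ⟨hp, hd⟩
    refine ⟨hp, fun q _ => ?_⟩
    have h : (p.length : ℚ≥0) ≤ q.length := by
      rw [Nat.cast_le, hd]; exact SimpleGraph.dist_le q
    exact (I.toGMEG_weight p).trans_le (h.trans_eq (I.toGMEG_weight q).symm)

theorem toGMEG_monitors (I : MEG) (x y : Fin I.n) (e : Sym2 (Fin I.n)) :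
    I.toGMEG.Monitors x y e ↔ I.Monitors x y e :=
  ⟨fun h p hp hd => h p ((I.toGMEG_isShortest p).2 ⟨hp, hd⟩),
    fun h p hp => h p ((I.toGMEG_isShortest p).1 hp).1 ((I.toGMEG_isShortest p).1 hp).2⟩

theorem toGMEG_isSolution (I : MEG) (M : Finset (Fin I.n)) :
    I.toGMEG.IsSolution M ↔ I.IsSolution M := by
  constructor
  · intro h e he
    obtain ⟨x, hx, y, hy, hne, hxy⟩ := h e he
    exact ⟨x, hx, y, hy, hne, (I.toGMEG_monitors x y e).1 hxy⟩
  · intro h e he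
    obtain ⟨x, hx, y, hy, hne, hxy⟩ := h e he
    exact ⟨x, hx, y, hy, hne, (I.toGMEG_monitors x y e).2 hxy⟩

theorem toGMEG_cost (I : MEG) (M : Finset (Fin I.n)) : I.toGMEG.cost M = M.card :=
  (Finset.card_eq_sum_ones M).symm

/-- Endpoints of an edge have distance one, and the edge itself is the only walk of length one
between them. -/
theorem isSolution_univ (I : MEG) : I.IsSolution Finset.univ := by
  intro e he
  induction e using Sym2.ind with
  | _ x y =>
    have hadj : I.G.Adj x y := he
    refine ⟨x, Finset.mem_univ _, y, Finset.mem_univ _, hadj.ne, fun p _ hd => ?_⟩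
    rw [SimpleGraph.dist_eq_one_iff_adj.2 hadj] at hd
    cases p with
    | nil => simp at hd
    | cons h q =>
      rw [SimpleGraph.Walk.length_cons] at hd
      obtain rfl := q.eq_of_length_eq_zero (by omega)
      simp

/-- The adjacency matrix plays all roles at once: on edges, numerators and denominators are `1`, and
the targets are exactly the edges. -/
theorem represents_input (I : MEG) :
    RAM.Represents false I.toGMEG ((RAM.load I.input).write 6 0 I.n) := by
  have hadj : ∀ u v : Fin I.n, ((RAM.load I.input).write 6 0 I.n) 1 (u * I.n + v) =
      RAM.ind (I.G.Adj u v) := by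
    intro u v
    rw [RAM.Store.write_of_ne (by omega)]
    simp only [RAM.load, MEG.input, List.getD_cons_succ, List.getD_cons_zero, RAM.matrixList_getD]
    rw [RAM.ind]
  exact {
    bound := RAM.Store.write_self _ _ _ _
    adj := hadj
    num := fun u v h => (hadj u v).trans (RAM.ind_true h)
    den := fun u v h => (hadj u v).trans (RAM.ind_true h)
    target := hadj
    cost := fun _ => rfl }

end MEG

/-! ### Approximation ratios -/

theorem GMEG.cost_le_univ (I : GMEG) (M : Finset (Fin I.n)) : I.cost M ≤ I.cost Finset.univ :=
  Finset.sum_le_sum_of_subset (Finset.subset_univ _)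

/-- The product of the two upper bounds for `m` bounds `m ^ 2`. -/
theorem le_sqrt_mul_of_le_sq {m k c l : ℝ} (hm : 0 ≤ m) (hk : 0 ≤ k) (h₁ : m ≤ 2 * k ^ 2 * l)
    (h₂ : m ≤ c) (hl : 0 ≤ l) : m ≤ Real.sqrt (2 * c * l) * k := by
  rw [← Real.sqrt_sq hk, ← Real.sqrt_mul (by positivity [hm.trans h₂])]
  refine Real.le_sqrt_of_sq_le ?_
  calc m ^ 2 = m * m := sq m
    _ ≤ (2 * k ^ 2 * l) * c := mul_le_mul h₁ h₂ hm (by positivity)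
    _ = 2 * c * l * k ^ 2 := by ring

theorem mainTheorem6 :
    (∃ (P : RAM.Prog) (T : Polynomial ℕ), ∀ I : GMEG,
      (∃ M : Finset (Fin I.n), I.IsSolution M) →
        ∃ M : Finset (Fin I.n),
          RAM.OutputsWithin P I.input (T.eval (RAM.inputLength I.input)) M ∧
          I.IsSolution M ∧
          ∀ Mstar : Finset (Fin I.n), I.IsOptimal Mstar →
            (I.cost M : ℝ) ≤ 2 * (I.cost Mstar : ℝ) ^ 2 * Real.log I.n ∧
            (I.cost M : ℝ) ≤ (2 * (I.cost Mstar : ℝ) * Real.log I.n) * I.cost Mstar ∧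
            (I.cost M : ℝ) ≤
              Real.sqrt (2 * (I.cost Finset.univ : ℝ) * Real.log I.n) * I.cost Mstar) ∧
    (∃ (P : RAM.Prog) (T : Polynomial ℕ) (C : ℝ), ∀ I : MEG,
        ∃ M : Finset (Fin I.n),
          RAM.OutputsWithin P I.input (T.eval (RAM.inputLength I.input)) M ∧
          I.IsSolution M ∧
          ∀ Mstar : Finset (Fin I.n), I.IsOptimal Mstar →
            (M.card : ℝ) ≤ C * Real.sqrt (I.n * Real.log I.n) * Mstar.card) := by
  constructor
  · obtain ⟨P, T, hPT⟩ := (RAM.mainCmd true).exists_prog (RAM.mainCmd_WF true)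
    refine ⟨P, T, fun I hex => ?_⟩
    obtain ⟨h1, h2⟩ := RAM.mainCmd_spec (RAM.represents_input I) hex
    refine ⟨_, hPT I.input I.n rfl (RAM.le_inputLength (List.mem_cons_of_mem _ List.mem_cons_self)),
      h1, fun Mstar hM => ?_⟩
    have h3 := h2 Mstar hM.1
    refine ⟨h3, h3.trans_eq (by ring), le_sqrt_mul_of_le_sq (Nat.cast_nonneg _) (Nat.cast_nonneg _)
      h3 (by exact_mod_cast I.cost_le_univ _) (Real.log_natCast_nonneg _)⟩
  · obtain ⟨P, T, hPT⟩ := (RAM.mainCmd false).exists_prog (RAM.mainCmd_WF false)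
    -- The constant is that of part (a), with total cost `n`.
    refine ⟨P, T, Real.sqrt 2, fun I => ?_⟩
    obtain ⟨h1, h2⟩ := RAM.mainCmd_spec I.represents_input
      ⟨Finset.univ, (I.toGMEG_isSolution _).2 I.isSolution_univ⟩
    refine ⟨_, hPT I.input I.n rfl (RAM.le_inputLength (List.mem_cons_of_mem _ List.mem_cons_self)),
      (I.toGMEG_isSolution _).1 h1, fun Mstar hM => ?_⟩
    have h3 := h2 Mstar ((I.toGMEG_isSolution _).2 hM.1)
    rw [I.toGMEG_cost Mstar, show I.toGMEG.cost _ = _ from I.toGMEG_cost _] at h3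
    rw [← Real.sqrt_mul zero_le_two, ← mul_assoc]
    exact le_sqrt_mul_of_le_sq (Nat.cast_nonneg _) (Nat.cast_nonneg _) h3
      (by exact_mod_cast (Finset.card_le_univ _).trans_eq (Fintype.card_fin _))
      (Real.log_natCast_nonneg _)
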